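/- Let $z=(z_1,z_2,z_3)\in\mathbb C^3$, $w\in\mathbb C^7$, and let $M\subset\mathbb C^{10}$ be the quadric of real codimension $7$ given by $$\begin{aligned} \operatorname{Re}w_1&=z_1\bar z_1+z_2\bar z_2-z_3\bar z_3, & \operatorname{Re}w_2&=z_1\bar z_1-z_2\bar z_2, & \operatorname{Re}w_3&=z_2\bar z_3+z_3\bar z_2,\\ \operatorname{Re}w_4&=z_1\bar z_2+z_2\bar z_1, & \operatorname{Re}w_5&=iz_1\bar z_3-iz_3\bar z_1, & \operatorname{Re}w_6&=iz_2\bar z_3-iz_3\bar z_2,\\ \operatorname{Re}w_7&=iz_1\bar z_2-iz_2\bar z_1. \end{aligned}$$ Write the equations as $\operatorname{Re}w_j={}^t\bar z A_jz$ with Hermitian $3\times3$ matrices $A_1,\dots,A_7$, and put $r_j=\operatorname{Re}w_j-{}^t\bar zA_jz$. *Definitions.* $M$ is strongly pseudoconvex at $0$ if $\sum_j b_jA_j$ is positive definite for some $b\in\mathbb R^7$. It is $\mathfrak D$-nondegenerate at $0$ if there are $b\in\mathbb R^7$ with $\sum_jb_jA_j$ invertible and $V\in\mathbb C^3$ such that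 the real matrix $\operatorname{Re}\big({}^t\bar D(\sum_jb_jA_j)^{-1}D\big)$ is invertible, where $D$ is the matrix with columns $A_1V,\dots,A_7V$. Let $b\in\mathbb R^7$ with $\sum_j b_jA_j$ invertible. For $a\in\mathbb C^7$ put $P=\sum_ja_jA_j$ and $A=\sum_j(b_j-a_j-\bar a_j)A_j$, and let $X$ be the unique solution of $PX^2+AX+{}^t\bar P=0$ with operator norm $\|X\|<1$ (it exists if $a$ is small enough). $M$ is $\mathfrak D(a)$-nondegenerate at $0$ (relative to $b$) if there is $V\in\mathbb C^3$, called a witness, such that the real $7\times7$ matrix $\operatorname{Re}\big(\sum_{r\ge0}{}^t\bar V\,{}^t\bar X^rA_jA^{-1}A_sX^rV\big)_{j,s}$ is invertible. Let $\Delta$ be the open unit disc in $\mathbb C$. Let $\mathcal S_0(M)$ be the set, with the topology of uniform convergence, of continuous maps $\boldsymbol f=(f,\tilde f):\overline\Delta\to T^*\mathbb C^{10}=\mathbb C^{10}\times\mathbb C^{10}$, holomorphic in $\Delta$, such that $f$ is nonconstant, $f(\partial\Delta)\subset M$, for some functions $c_1,\dots,c_7:\partial\Delta\to\mathbb R$ one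 has $\sum_jc_j(\zeta)\partial r_j(0)\ne0$ and $\tilde f(\zeta)=\zeta\sum_jc_j(\zeta)\,\partial r_j(f(\zeta))$ for all $\zeta\in\partial\Delta$, and $\boldsymbol f(1)=(0,0,0,b/2)$. The lift parametrized by $(a,V)\in\mathbb C^7\times\mathbb C^3$ is the element $(h,g,\tilde h,\tilde g)$ of $\mathcal S_0(M)$ with $h(\zeta)=(1-\zeta)(I-\zeta X)^{-1}(I-X)V$ and $\tilde g_j(\zeta)=\frac12\big(a_j+(b_j-a_j-\bar a_j)\zeta+\bar a_j\zeta^2\big)$. The $1$-jet map is $\mathfrak j_1:\mathcal S_0(M)\ni\boldsymbol f\mapsto\boldsymbol f'(1)$; its values are identified with points of $\mathbb C^3\times\mathbb R^7\times\mathbb R^7$ through the injection $(v,t,s)\mapsto\big(v,\,t,\,{}^t\bar v\sum_jb_jA_j,\,\tfrac b2+is\big)$. **Theorem.** $M$ is neither strongly pseudoconvex nor $\mathfrak D$-nondegenerate at $0$. There is $\varepsilon_0>0$ such that for every real $\varepsilon$ with $0<|\varepsilon|<\varepsilon_0$, with $a=(\varepsilon,\varepsilon,0,0,0,0,0)$,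 $b=(1+2\varepsilon,2\varepsilon,0,0,0,0,0)$ (so that $A=A_1$) and $V=(1,1,1)$: (i) $M$ is $\mathfrak D(a)$-nondegenerate at $0$, with witness $V$; (ii) the $1$-jet map $\mathfrak j_1$ on $\mathcal S_0(M)$ is a local diffeomorphism at the lift parametrized by $(a,V)$; that is, the parameters give a homeomorphism from an open neighbourhood of $(a,V)$ in $\mathbb C^7\times\mathbb C^3$ onto an open subset of $\mathcal S_0(M)$, the lifts in this set are differentiable at $\zeta=1$ with derivative in the image of the above injection, and in these parameters $\mathfrak j_1$, as a map into $\mathbb C^3\times\mathbb R^7\times\mathbb R^7$, is a $\mathcal C^\infty$ local diffeomorphism at $(a,V)$. -/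

import Mathlib

open scoped Matrix

noncomputable section

/-- The space `ℂⁿ × ℂᵈ = ℂⁿ⁺ᵈ` with coordinates `(z, w)`. It also serves for its cotangent
spaces, a covector being given by its coefficients with respect to `dz₁, …, dzₙ, dw₁, …, dw_d`. -/
abbrev CRSpace (n d : ℕ) : Type := (Fin n → ℂ) × (Fin d → ℂ)

/-- The quadric `Re w_j = ᵗz̄ A_j z`, `j = 1, …, d` (the right-hand side is real when `A_j` is
Hermitian). -/
def quadric {n d : ℕ} (A : Fin d → Matrix (Fin n) (Fin n) ℂ) : Set (CRSpace n d) :=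
  {p | ∀ j, (p.2 j).re = (star p.1 ⬝ᵥ A j *ᵥ p.1).re}

/-- The real-linear combination `∑ b_j A_j`. -/
def pencil {n d : ℕ} (A : Fin d → Matrix (Fin n) (Fin n) ℂ) (b : Fin d → ℝ) :
    Matrix (Fin n) (Fin n) ℂ :=
  ∑ j, (b j : ℂ) • A j

/-! ### Nondegeneracy conditions at the origin -/

open scoped ComplexOrder in
/-- Strong pseudoconvexity at `0`: some real combination of the `A_j` is positive definite. -/
def IsStronglyPseudoconvex {n d : ℕ} (A : Fin d → Matrix (Fin n) (Fin n) ℂ) : Prop :=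
  ∃ b : Fin d → ℝ, (pencil A b).PosDef

/-- The `n × d` matrix whose `j`-th column is `A_j V`. -/
def columnMatrix {n d : ℕ} (A : Fin d → Matrix (Fin n) (Fin n) ℂ) (V : Fin n → ℂ) :
    Matrix (Fin n) (Fin d) ℂ :=
  Matrix.of fun i j => (A j *ᵥ V) i

/-- `𝔇`-nondegeneracy at `0`: for some `b` with `∑ b_j A_j` invertible and some `V`, the real
matrix `Re (ᵗD̄ (∑ b_j A_j)⁻¹ D)` is invertible, where `D` has columns `A_j V`. -/
def IsDNondegenerate {n d : ℕ} (A : Fin d → Matrix (Fin n) (Fin n) ℂ) : Prop :=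
  ∃ b : Fin d → ℝ, IsUnit (pencil A b) ∧ ∃ V : Fin n → ℂ,
    IsUnit (((columnMatrix A V)ᴴ * (pencil A b)⁻¹ * columnMatrix A V).map Complex.re)

/-- `P = ∑ a_j A_j`. -/
def coeffP {n d : ℕ} (A : Fin d → Matrix (Fin n) (Fin n) ℂ) (a : Fin d → ℂ) :
    Matrix (Fin n) (Fin n) ℂ :=
  ∑ j, a j • A j

/-- `∑ (b_j - a_j - ā_j) A_j`. -/
def coeffA {n d : ℕ} (A : Fin d → Matrix (Fin n) (Fin n) ℂ) (b : Fin d → ℝ) (a : Fin d → ℂ) :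
    Matrix (Fin n) (Fin n) ℂ :=
  ∑ j, ((b j : ℂ) - a j - star (a j)) • A j

open scoped Matrix.Norms.L2Operator in
/-- `X` is the unique solution of `P X² + A X + ᵗP̄ = 0` with operator norm `‖X‖ < 1`. -/
def IsSmallSolution {n d : ℕ} (A : Fin d → Matrix (Fin n) (Fin n) ℂ) (b : Fin d → ℝ)
    (a : Fin d → ℂ) (X : Matrix (Fin n) (Fin n) ℂ) : Prop :=
  (coeffP A a * X ^ 2 + coeffA A b a * X + (coeffP A a)ᴴ = 0 ∧ ‖X‖ < 1) ∧
    ∀ Y : Matrix (Fin n) (Fin n) ℂ,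
      coeffP A a * Y ^ 2 + coeffA A b a * Y + (coeffP A a)ᴴ = 0 → ‖Y‖ < 1 → Y = X

/-- The `d × d` real matrix `Re (∑_r ᵗV̄ ᵗX̄ʳ A_j A⁻¹ A_s Xʳ V)_{j,s}`. -/
def DaMatrix {n d : ℕ} (A : Fin d → Matrix (Fin n) (Fin n) ℂ) (b : Fin d → ℝ)
    (a : Fin d → ℂ) (X : Matrix (Fin n) (Fin n) ℂ) (V : Fin n → ℂ) :
    Matrix (Fin d) (Fin d) ℝ :=
  Matrix.of fun j s =>
    (∑' r : ℕ, star (X ^ r *ᵥ V) ⬝ᵥ (A j * (coeffA A b a)⁻¹ * A s) *ᵥ (X ^ r *ᵥ V)).re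

/-- `V` witnesses the `𝔇(a)`-nondegeneracy at `0` (relative to `b`, with `∑ b_j A_j` invertible). -/
def IsDaNondegenerateAt {n d : ℕ} (A : Fin d → Matrix (Fin n) (Fin n) ℂ) (b : Fin d → ℝ)
    (a : Fin d → ℂ) (V : Fin n → ℂ) : Prop :=
  IsUnit (pencil A b) ∧ IsUnit (coeffA A b a) ∧
    ∃ X, IsSmallSolution A b a X ∧ IsUnit (DaMatrix A b a X V)

/-- `𝔇(a)`-nondegeneracy at `0`, relative to `b`. -/
def IsDaNondegenerate {n d : ℕ} (A : Fin d → Matrix (Fin n) (Fin n) ℂ) (b : Fin d → ℝ)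
    (a : Fin d → ℂ) : Prop :=
  ∃ V : Fin n → ℂ, IsDaNondegenerateAt A b a V

/-! ### Lifts of stationary discs -/

/-- The defining function `r_j = Re w_j - ᵗz̄ A_j z`. -/
def definingFun {n d : ℕ} (A : Fin d → Matrix (Fin n) (Fin n) ℂ) (j : Fin d)
    (p : CRSpace n d) : ℝ :=
  (p.2 j).re - (star p.1 ⬝ᵥ A j *ᵥ p.1).re

/-- The Wirtinger derivative `½ (D_v φ - i D_{iv} φ)` of a real-valued function. -/
def wirtinger {n d : ℕ} (φ : CRSpace n d → ℝ) (p v : CRSpace n d) : ℂ :=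
  (1 / 2 : ℂ) *
    ((fderiv ℝ φ p v : ℝ) - Complex.I * (fderiv ℝ φ p (Complex.I • v) : ℝ))

/-- The covector `∂r_j = ∑ ∂r_j/∂z_k dz_k + ∑ ∂r_j/∂w_k dw_k` at `p`. -/
def delR {n d : ℕ} (A : Fin d → Matrix (Fin n) (Fin n) ℂ) (j : Fin d) (p : CRSpace n d) :
    CRSpace n d :=
  (fun k => wirtinger (definingFun A j) p (Pi.single k 1, 0),
   fun k => wirtinger (definingFun A j) p (0, Pi.single k 1))

/-- For Hermitian `A_j`, `∂r_j = -ᵗz̄ A_j dz + ½ dw_j`. -/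
theorem delR_eq {n d : ℕ} (A : Fin d → Matrix (Fin n) (Fin n) ℂ) (j : Fin d)
    (hA : (A j).IsHermitian) (p : CRSpace n d) :
    delR A j p = (-(star p.1 ᵥ* A j), Pi.single j (1 / 2)) := by
  have key : ∀ v : CRSpace n d, fderiv ℝ (definingFun A j) p v =
      (v.2 j).re - 2 * (star p.1 ⬝ᵥ A j *ᵥ v.1).re := by
    intro v
    have hlin : HasDerivAt (fun t : ℝ => p + t • v) v 0 := by
      simpa using ((hasDerivAt_id (0 : ℝ)).smul_const v).const_add p
    have hdiff : DifferentiableAt ℝ (definingFun A j) p := by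
      have : Differentiable ℝ (definingFun A j) := by
        have h1 : ∀ i, Differentiable ℝ fun q : CRSpace n d => star (q.1 i) := fun i => by
          have : Differentiable ℝ fun q : CRSpace n d => q.1 i := by fun_prop
          exact (Complex.conjCLE.differentiable).comp this
        have h2 : Differentiable ℝ fun q : CRSpace n d =>
            q.2 j - ∑ i, star (q.1 i) * ∑ k, A j i k * q.1 k := by fun_prop
        have h3 := (Complex.reCLM.differentiable).comp h2
        exact h3
      exact this p
    have hc : HasDerivAt (fun t : ℝ => definingFun A j (p + t • v))
        (fderiv ℝ (definingFun A j) p v) 0 := by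
      have := hdiff.hasFDerivAt
      have h' : HasFDerivAt (definingFun A j) (fderiv ℝ (definingFun A j) p) (p + (0 : ℝ) • v) := by
        simpa using this
      exact h'.comp_hasDerivAt 0 hlin
    have hsymm : (star v.1 ⬝ᵥ A j *ᵥ p.1).re = (star p.1 ⬝ᵥ A j *ᵥ v.1).re := by
      have : star (star v.1 ⬝ᵥ A j *ᵥ p.1) = star p.1 ⬝ᵥ A j *ᵥ v.1 := by
        rw [Matrix.star_dotProduct, star_star, Matrix.star_mulVec, hA.eq, Matrix.dotProduct_mulVec,
          dotProduct_comm]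
      rw [← this]
      simp
    have hexp : (fun t : ℝ => definingFun A j (p + t • v)) = fun t : ℝ =>
        definingFun A j p + t * ((v.2 j).re - 2 * (star p.1 ⬝ᵥ A j *ᵥ v.1).re)
          - t ^ 2 * (star v.1 ⬝ᵥ A j *ᵥ v.1).re := by
      funext t
      have hst : star (t • v.1) = t • star v.1 := by
        ext i; simp
      simp only [definingFun, Prod.fst_add, Prod.snd_add, Prod.smul_fst, Prod.smul_snd, star_add,
        hst, Matrix.mulVec_add, Matrix.mulVec_smul, add_dotProduct, dotProduct_add,
        smul_dotProduct, dotProduct_smul, Complex.add_re, Complex.smul_re, Pi.add_apply,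
        Pi.smul_apply, smul_eq_mul, hsymm]
      ring
    have hd : HasDerivAt (fun t : ℝ => definingFun A j (p + t • v))
        ((v.2 j).re - 2 * (star p.1 ⬝ᵥ A j *ᵥ v.1).re) 0 := by
      rw [hexp]
      have h1 := (((hasDerivAt_id (0 : ℝ)).mul_const
        ((v.2 j).re - 2 * (star p.1 ⬝ᵥ A j *ᵥ v.1).re)).const_add (definingFun A j p)).sub
        (((hasDerivAt_id (0 : ℝ)).pow 2).mul_const (star v.1 ⬝ᵥ A j *ᵥ v.1).re)
      exact h1.congr_deriv (by simp)
    exact hc.unique hd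
  refine Prod.ext (funext fun k => ?_) (funext fun k => ?_)
  · simp only [delR, wirtinger, key]
    simp only [Prod.smul_fst, Prod.smul_snd, Matrix.mulVec_smul, dotProduct_smul]
    rw [Matrix.dotProduct_mulVec, dotProduct_single_one]
    apply Complex.ext <;> simp
  · simp only [delR, wirtinger, key]
    by_cases h : k = j
    · subst h
      apply Complex.ext <;> simp
    · simp [h, Ne.symm h]

/-- Continuous maps `𝐟 = (f, f̃)` from the closed unit disc to `T*ℂⁿ⁺ᵈ`, with the topology of
uniform convergence. -/
abbrev DiscMap (n d : ℕ) : Type :=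
  C(Metric.closedBall (0 : ℂ) 1, CRSpace n d × CRSpace n d)

open Classical in
/-- Extension by `0` of a map on the closed disc; only its values on the closed disc are used. -/
def discExtend {n d : ℕ} (F : DiscMap n d) (ζ : ℂ) : CRSpace n d × CRSpace n d :=
  if h : ζ ∈ Metric.closedBall (0 : ℂ) 1 then F ⟨ζ, h⟩ else 0

/-- The set `𝒮(M)` of holomorphic lifts `𝐟 = (f, f̃)` of nonconstant stationary discs `f` of the
quadric: `f(∂Δ) ⊂ M` and, on `∂Δ`, `f̃(ζ) = ζ ∑ c_j(ζ) ∂r_j(f(ζ))` with real functions `c_j` such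
that `∑ c_j(ζ) ∂r_j(0) ≠ 0`. -/
def stationaryLifts {n d : ℕ} (A : Fin d → Matrix (Fin n) (Fin n) ℂ) : Set (DiscMap n d) :=
  {F | DifferentiableOn ℂ (discExtend F) (Metric.ball 0 1) ∧
    (¬ ∃ p, ∀ ζ, (F ζ).1 = p) ∧
    (∀ ζ : Metric.closedBall (0 : ℂ) 1, ‖(ζ : ℂ)‖ = 1 → (F ζ).1 ∈ quadric A) ∧
    ∃ c : Fin d → ℂ → ℝ, ∀ ζ : Metric.closedBall (0 : ℂ) 1, ‖(ζ : ℂ)‖ = 1 →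
      ∑ j, c j ζ • delR A j 0 ≠ 0 ∧
      (F ζ).2 = (ζ : ℂ) • ∑ j, c j ζ • delR A j (F ζ).1}

/-- The set `𝒮₀(M)` of lifts whose value at `ζ = 1` is `(0, 0, 0, b/2)`, with the topology of
uniform convergence on the closed disc. -/
def pointedLifts {n d : ℕ} (A : Fin d → Matrix (Fin n) (Fin n) ℂ) (b : Fin d → ℝ) :
    Set (DiscMap n d) :=
  {F | F ∈ stationaryLifts A ∧
    discExtend F 1 = ((0, 0), (0, fun j => (b j : ℂ) / 2))}

/-- The lift `𝐟 = (h, g, h̃, g̃)` of `𝒮₀(M)` has parameters `(a, V)`: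
`h(ζ) = (1 - ζ) (I - ζX)⁻¹ (I - X) V`, where `X` is the small solution of the matrix equation, and
`g̃_j(ζ) = ζ c_j(ζ) / 2` with `c_j(ζ) = a_j ζ̄ + (b_j - a_j - ā_j) + ā_j ζ` on the unit circle.
The components `g` and `h̃` are then determined by membership in `𝒮₀(M)`. -/
def HasParameters {n d : ℕ} (A : Fin d → Matrix (Fin n) (Fin n) ℂ) (b : Fin d → ℝ)
    (F : DiscMap n d) (q : (Fin d → ℂ) × (Fin n → ℂ)) : Prop :=
  ∃ X, IsSmallSolution A b q.1 X ∧ ∀ ζ : Metric.closedBall (0 : ℂ) 1,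
    (F ζ).1.1 = (1 - (ζ : ℂ)) • ((1 - (ζ : ℂ) • X)⁻¹ *ᵥ ((1 - X) *ᵥ q.2)) ∧
    ∀ j, (F ζ).2.2 j =
      (q.1 j + ((b j : ℂ) - q.1 j - star (q.1 j)) * ζ + star (q.1 j) * (ζ : ℂ) ^ 2) / 2

/-- The real-affine injection `(v, t, s) ↦ (v, t, ᵗv̄ ∑ b_j A_j, b/2 + i s)` of `ℂⁿ × ℝᵈ × ℝᵈ` into
`T*ℂⁿ⁺ᵈ`, through which the derivatives `𝐟'(1)`, `𝐟 ∈ 𝒮₀(M)`, are identified with points of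
`ℂⁿ × ℝᵈ × ℝᵈ`. -/
def jetInclusion {n d : ℕ} (A : Fin d → Matrix (Fin n) (Fin n) ℂ) (b : Fin d → ℝ)
    (y : (Fin n → ℂ) × (Fin d → ℝ) × (Fin d → ℝ)) : CRSpace n d × CRSpace n d :=
  ((y.1, fun j => (y.2.1 j : ℂ)),
   (star y.1 ᵥ* pencil A b, fun j => (b j : ℂ) / 2 + Complex.I * (y.2.2 j : ℂ)))

open scoped Manifold ContDiff in
/-- The `1`-jet map `𝔧₁ : 𝐟 ↦ 𝐟'(1)` on `𝒮₀(M)` is a local diffeomorphism at the lift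
parametrized by `q₀ = (a, V)`: the parameters `(a, V)` form a chart `e` of `𝒮₀(M)` around that
lift (a homeomorphism of an open set of parameters onto an open subset of `𝒮₀(M)`), and in this
chart `𝔧₁`, with values identified with points of `ℂⁿ × ℝᵈ × ℝᵈ`, is a local diffeomorphism at
`q₀`. -/
def OneJetIsLocalDiffeoAt {n d : ℕ} (A : Fin d → Matrix (Fin n) (Fin n) ℂ) (b : Fin d → ℝ)
    (q₀ : (Fin d → ℂ) × (Fin n → ℂ)) : Prop :=
  ∃ e : OpenPartialHomeomorph ((Fin d → ℂ) × (Fin n → ℂ)) (pointedLifts A b),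
    q₀ ∈ e.source ∧
    (∀ q ∈ e.source, HasParameters A b (e q : DiscMap n d) q) ∧
    ∃ Ψ : (Fin d → ℂ) × (Fin n → ℂ) → (Fin n → ℂ) × (Fin d → ℝ) × (Fin d → ℝ),
      (∀ q ∈ e.source, HasDerivWithinAt (discExtend (e q : DiscMap n d))
        (jetInclusion A b (Ψ q)) (Metric.closedBall 0 1) 1) ∧
      IsLocalDiffeomorphAt 𝓘(ℝ, (Fin d → ℂ) × (Fin n → ℂ))
        𝓘(ℝ, (Fin n → ℂ) × (Fin d → ℝ) × (Fin d → ℝ)) ∞ Ψ q₀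

/-! ### The example -/

/-- The matrices `A_1, …, A_7` of the seven Hermitian forms, written as `ᵗz̄ A_j z`. -/
def exampleForms : Fin 7 → Matrix (Fin 3) (Fin 3) ℂ :=
  ![!![1, 0, 0; 0, 1, 0; 0, 0, -1],
    !![1, 0, 0; 0, -1, 0; 0, 0, 0],
    !![0, 0, 0; 0, 0, 1; 0, 1, 0],
    !![0, 1, 0; 1, 0, 0; 0, 0, 0],
    !![0, 0, -Complex.I; 0, 0, 0; Complex.I, 0, 0],
    !![0, 0, 0; 0, 0, -Complex.I; 0, Complex.I, 0],
    !![0, -Complex.I, 0; Complex.I, 0, 0; 0, 0, 0]]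

/-- The submanifold of `ℂ¹⁰` under study, by its seven equations (both sides in `ℂ`). -/
theorem mem_quadric_exampleForms (z : Fin 3 → ℂ) (w : Fin 7 → ℂ) :
    (z, w) ∈ quadric exampleForms ↔
      ((w 0).re : ℂ) = z 0 * star (z 0) + z 1 * star (z 1) - z 2 * star (z 2) ∧
      ((w 1).re : ℂ) = z 0 * star (z 0) - z 1 * star (z 1) ∧
      ((w 2).re : ℂ) = z 1 * star (z 2) + z 2 * star (z 1) ∧
      ((w 3).re : ℂ) = z 0 * star (z 1) + z 1 * star (z 0) ∧
      ((w 4).re : ℂ) = Complex.I * z 0 * star (z 2) - Complex.I * z 2 * star (z 0) ∧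
      ((w 5).re : ℂ) = Complex.I * z 1 * star (z 2) - Complex.I * z 2 * star (z 1) ∧
      ((w 6).re : ℂ) = Complex.I * z 0 * star (z 1) - Complex.I * z 1 * star (z 0) := by
  simp only [quadric, Set.mem_ofPred_eq, Fin.forall_fin_succ, IsEmpty.forall_iff, and_true]
  simp [exampleForms, dotProduct, Matrix.mulVec, Fin.sum_univ_three, Complex.ext_iff]
  grind

end

/-!
On the unit circle the Hermitian matrix `∑ c_j(ζ) A_j` factors as `(1 - ζX)⋆ (A + PX) (1 - ζX)`,
where `X` is the small solution of the matrix equation. Boundary uniqueness on the disc then forces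
a pointed lift to be the explicit rational one determined by its parameters `(a, V)`, in which the
component `g` involves the solutions `K_j` of the Stein equations `K_j - X⋆ K_j X = A_j`. The
implicit function theorem makes `X` and the `K_j` analytic in `a`.

In the directions of `V` and `Im a` the `1`-jet is visibly injective. In the directions of `Re a`
its derivative is, up to the factor `-4`, the real matrix `Re (ᵗŪ G_{js} U)`, where
`U = (1 - X)² V` and `G_{js} - X⋆ G_{js} X = K_j (A + PX)⁻¹ K_s`.

In the example `P`, `A` and `X` are diagonal, and both this matrix and that of the
`𝔇(a)`-condition take the form `Re ∑ u_k u_l κ'_{kl} (K_j diag(δ) K_s)_{kl}` with `K_j = A_j ⊙ κ`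
and kernels `κ'`, `κ` of the shape `(1 - x_k x_l)⁻¹`. At `ε = 0` this real `7 × 7` matrix has a
two-dimensional kernel. The two relations persist, explicitly, for every `ε` if `κ'` is replaced by
`1`, and they are broken by the term `u_k u_l x_k x_l` of order `ε²` in the expansion of
`u_k u_l κ'_{kl}`.
-/

noncomputable section

/-! ### Boundary uniqueness on the unit disc -/

section BoundaryUniqueness

open Metric

theorem eq_of_re_eq_zero_on_frontier {f : ℂ → ℂ} {U : Set ℂ} (hb : Bornology.IsBounded U)
    (ho : IsOpen U) (hc : IsConnected U) (hf : DiffContOnCl ℂ f U)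
    (h : ∀ z ∈ frontier U, (f z).re = 0) {z w : ℂ} (hz : z ∈ closure U) (hw : w ∈ closure U) :
    f z = f w := by
  have re_nonpos : ∀ {g : ℂ → ℂ}, DiffContOnCl ℂ g U → (∀ z ∈ frontier U, (g z).re = 0) →
      ∀ z ∈ closure U, (g z).re ≤ 0 := by
    intro g hg h0 z hz
    have hle := Complex.norm_le_of_forall_mem_frontier_norm_le hb
      (Complex.differentiable_exp.comp_diffContOnCl hg) (C := 1)
      (fun w hw => by simp [Complex.norm_exp, h0 w hw]) hz
    simpa [Complex.norm_exp] using hle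
  have re_eq_zero : ∀ z ∈ closure U, (f z).re = 0 := fun z hz =>
    le_antisymm (re_nonpos hf h z hz)
      (by simpa using re_nonpos hf.neg (fun w hw => by simp [h w hw]) z hz)
  obtain ⟨c, hconst⟩ := (hf.differentiableOn.analyticOnNhd ho).eq_const_of_re_eq_const
    (fun z hz => re_eq_zero z (subset_closure hz)) ho hc
  have hcl : Set.EqOn f (fun _ => c) (closure U) :=
    Set.EqOn.of_subset_closure hconst hf.continuousOn continuousOn_const subset_closure subset_rfl
  rw [hcl hz, hcl hw]

variable {f g : ℂ → ℂ} {z w ζ : ℂ}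

theorem eq_of_re_eq_zero_on_circle (hf : DiffContOnCl ℂ f (ball 0 1))
    (h : ∀ ζ : ℂ, ‖ζ‖ = 1 → (f ζ).re = 0) (hz : z ∈ closedBall (0 : ℂ) 1)
    (hw : w ∈ closedBall (0 : ℂ) 1) : f z = f w := by
  rw [← closure_ball _ one_ne_zero] at hz hw
  refine eq_of_re_eq_zero_on_frontier isBounded_ball isOpen_ball (isConnected_ball one_pos) hf
    (fun ζ hζ => h ζ ?_) hz hw
  rwa [frontier_ball _ one_ne_zero, mem_sphere_zero_iff_norm] at hζ

theorem eq_of_im_eq_zero_on_circle (hf : DiffContOnCl ℂ f (ball 0 1))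
    (h : ∀ ζ : ℂ, ‖ζ‖ = 1 → (f ζ).im = 0) (hz : z ∈ closedBall (0 : ℂ) 1)
    (hw : w ∈ closedBall (0 : ℂ) 1) : f z = f w :=
  mul_left_cancel₀ Complex.I_ne_zero <|
    eq_of_re_eq_zero_on_circle (f := fun z => Complex.I * f z) (hf.const_smul Complex.I)
      (fun ζ hζ => by simp [h ζ hζ]) hz hw

theorem eq_of_eq_star_on_circle (hf : DiffContOnCl ℂ f (ball 0 1))
    (hg : DiffContOnCl ℂ g (ball 0 1)) (h : ∀ ζ : ℂ, ‖ζ‖ = 1 → f ζ = star (g ζ))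
    (hz : z ∈ closedBall (0 : ℂ) 1) (hw : w ∈ closedBall (0 : ℂ) 1) : f z = f w := by
  have hadd : f z + g z = f w + g w :=
    eq_of_im_eq_zero_on_circle (hf.add hg) (fun ζ hζ => by simp [h ζ hζ]) hz hw
  have hsub : f z - g z = f w - g w :=
    eq_of_re_eq_zero_on_circle (hf.sub hg) (fun ζ hζ => by simp [h ζ hζ]) hz hw
  linear_combination (hadd + hsub) / 2

theorem eq_of_re_eq_on_circle (hf : DiffContOnCl ℂ f (ball 0 1))
    (hg : DiffContOnCl ℂ g (ball 0 1)) (h : ∀ ζ : ℂ, ‖ζ‖ = 1 → (f ζ).re = (g ζ).re)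
    (h₁ : f 1 = g 1) (hζ : ζ ∈ closedBall (0 : ℂ) 1) : f ζ = g ζ := by
  have hsub : f ζ - g ζ = f 1 - g 1 :=
    eq_of_re_eq_zero_on_circle (hf.sub hg) (fun ζ hζ => by simp [h ζ hζ]) hζ (by simp)
  linear_combination hsub + h₁

theorem diffContOnCl_dslope_zero (hf : DiffContOnCl ℂ f (ball 0 1)) :
    DiffContOnCl ℂ (dslope f 0) (ball 0 1) := by
  have hb : ball (0 : ℂ) 1 ∈ nhds 0 := ball_mem_nhds _ one_pos
  refine ⟨(Complex.differentiableOn_dslope hb).2 hf.differentiableOn, ?_⟩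
  exact (continuousOn_dslope (Filter.mem_of_superset hb subset_closure)).2
    ⟨hf.continuousOn, hf.differentiableOn.differentiableAt hb⟩

theorem eq_add_mul_dslope_zero (f : ℂ → ℂ) (ζ : ℂ) : f ζ = f 0 + ζ * dslope f 0 ζ := by
  have h : ζ * dslope f 0 ζ = f ζ - f 0 := by simpa using sub_smul_dslope f 0 ζ
  rw [h, add_sub_cancel]

theorem mul_star_eq_one_of_norm_eq_one (h : ‖ζ‖ = 1) : ζ * star ζ = 1 := by
  simpa [h] using Complex.mul_conj' ζ

theorem eq_affine_of_eq_mul_star_on_circle (hf : DiffContOnCl ℂ f (ball 0 1))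
    (hg : DiffContOnCl ℂ g (ball 0 1)) (h : ∀ ζ : ℂ, ‖ζ‖ = 1 → f ζ = ζ * star (g ζ))
    (hζ : ζ ∈ closedBall (0 : ℂ) 1) : f ζ = f 0 + ζ * (f 1 - f 0) := by
  have hlin : DiffContOnCl ℂ (fun z : ℂ => star (f 0) * z) (ball 0 1) :=
    (differentiable_id.const_mul _).diffContOnCl
  have hbdry : ∀ z : ℂ, ‖z‖ = 1 → dslope f 0 z = star (g z - star (f 0) * z) := by
    intro z hz
    rw [star_sub, star_mul', star_star]
    linear_combination star z * (h z hz - eq_add_mul_dslope_zero f z) +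
      (star (g z) - dslope f 0 z) * mul_star_eq_one_of_norm_eq_one hz
  have hconst : dslope f 0 ζ = dslope f 0 1 :=
    eq_of_eq_star_on_circle (diffContOnCl_dslope_zero hf) (hg.sub hlin) hbdry hζ (by simp)
  linear_combination eq_add_mul_dslope_zero f ζ + ζ * (hconst - eq_add_mul_dslope_zero f 1)

theorem eq_quadratic_of_eq_mul_real_on_circle {c : ℂ → ℝ} (hf : DiffContOnCl ℂ f (ball 0 1))
    (h : ∀ ζ : ℂ, ‖ζ‖ = 1 → f ζ = ζ * c ζ) (hζ : ζ ∈ closedBall (0 : ℂ) 1) :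
    f ζ = f 0 + (f 1 - f 0 - star (f 0)) * ζ + star (f 0) * ζ ^ 2 := by
  have hlin : DiffContOnCl ℂ (fun z : ℂ => star (f 0) * z) (ball 0 1) :=
    (differentiable_id.const_mul _).diffContOnCl
  have hbdry : ∀ z : ℂ, ‖z‖ = 1 → (dslope f 0 z - star (f 0) * z).im = 0 := by
    intro z hz
    have hslope : dslope f 0 z = c z - star z * f 0 := by
      linear_combination star z * (h z hz - eq_add_mul_dslope_zero f z) +
        (c z - dslope f 0 z) * mul_star_eq_one_of_norm_eq_one hz
    simp [hslope]
    ring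
  have hconst : dslope f 0 ζ - star (f 0) * ζ = dslope f 0 1 - star (f 0) * 1 :=
    eq_of_im_eq_zero_on_circle ((diffContOnCl_dslope_zero hf).sub hlin) hbdry hζ (by simp)
  linear_combination eq_add_mul_dslope_zero f ζ + ζ * (hconst - eq_add_mul_dslope_zero f 1)

end BoundaryUniqueness

/-! ### The equation `P X² + S X + P⋆ = 0` in a normed star ring -/

section SmallSolution

variable {R : Type*} [NormedRing R]

theorem eq_zero_of_eq_mul_mul {X Y Z : R} (hX : ‖X‖ < 1) (hY : ‖Y‖ < 1) (h : Z = X * Z * Y) :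
    Z = 0 := by
  by_contra hZ
  have hpos : 0 < ‖Z‖ := norm_pos_iff.2 hZ
  have hle : ‖Z‖ ≤ ‖X‖ * ‖Z‖ * ‖Y‖ :=
    calc ‖Z‖ = ‖X * Z * Y‖ := congrArg _ h
      _ ≤ ‖X‖ * ‖Z‖ * ‖Y‖ := norm_mul₃_le
  have hlt : ‖X‖ * ‖Z‖ * ‖Y‖ < ‖Z‖ :=
    calc ‖X‖ * ‖Z‖ * ‖Y‖ ≤ ‖X‖ * ‖Z‖ := mul_le_of_le_one_right (by positivity) hY.le
      _ < ‖Z‖ := mul_lt_of_lt_one_left hpos hX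
  exact hle.not_gt hlt

variable [StarRing R]

theorem star_coeff_eq_neg {P S X : R} (h : P * X ^ 2 + S * X + star P = 0) :
    star P = -((S + P * X) * X) := by
  rw [eq_neg_iff_add_eq_zero, ← h]
  noncomm_ring

variable [NormedStarGroup R] {P S X Y : R}

theorem isSelfAdjoint_add_mul (hS : IsSelfAdjoint S) (h : P * X ^ 2 + S * X + star P = 0)
    (hX : ‖X‖ < 1) : IsSelfAdjoint (S + P * X) := by
  have hP : star P = -((S + P * X) * X) := star_coeff_eq_neg h
  obtain ⟨M, hM⟩ : ∃ M, S + P * X = M := ⟨_, rfl⟩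
  rw [hM] at hP ⊢
  have hP' : P = -(star X * star M) := by
    simpa only [star_star, star_neg, star_mul] using congrArg star hP
  have hMS : M = S - star X * star M * X := by
    conv_lhs => rw [← hM, hP']
    noncomm_ring
  have hMS' : star M = S - star X * M * X := by
    conv_lhs => rw [hMS]
    simp only [star_sub, star_mul, star_star, hS.star_eq, mul_assoc]
  refine sub_eq_zero.1 (eq_zero_of_eq_mul_mul (X := star X) (by rwa [norm_star]) hX ?_)
  calc star M - M = S - star X * M * X - (S - star X * star M * X) :=
        congrArg₂ (· - ·) hMS' hMS
    _ = star X * (star M - M) * X := by noncomm_ring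

theorem coeff_eq_neg_star_mul (hS : IsSelfAdjoint S) (h : P * X ^ 2 + S * X + star P = 0)
    (hX : ‖X‖ < 1) : P = -(star X * (S + P * X)) := by
  simpa only [star_star, star_neg, star_mul, (isSelfAdjoint_add_mul hS h hX).star_eq] using
    congrArg star (star_coeff_eq_neg h)

theorem small_solution_unique (hS : IsSelfAdjoint S) (h : P * X ^ 2 + S * X + star P = 0)
    (hX : ‖X‖ < 1) (hu : IsUnit (S + P * X)) (hY : P * Y ^ 2 + S * Y + star P = 0)
    (hY' : ‖Y‖ < 1) : Y = X := by
  have hdiff : (S + P * X) * (Y - X) = -(P * (Y - X) * Y) := by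
    rw [eq_neg_iff_add_eq_zero, ← sub_self (0 : R)]
    nth_rewrite 1 [← hY]
    rw [← h]
    noncomm_ring
  have hfix : (S + P * X) * (Y - X) = star X * ((S + P * X) * (Y - X)) * Y := by
    conv_lhs => rw [hdiff, coeff_eq_neg_star_mul hS h hX]
    noncomm_ring
  exact sub_eq_zero.1 (hu.mul_right_eq_zero.1 (eq_zero_of_eq_mul_mul (by rwa [norm_star]) hY' hfix))

variable [NormedAlgebra ℂ R] [StarModule ℂ R]

theorem star_one_sub_smul_mul_mul (hS : IsSelfAdjoint S) (h : P * X ^ 2 + S * X + star P = 0)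
    (hX : ‖X‖ < 1) {ζ : ℂ} (hζ : ‖ζ‖ = 1) :
    star (1 - ζ • X) * (S + P * X) * (1 - ζ • X) = star ζ • P + S + ζ • star P := by
  have hP := star_coeff_eq_neg h
  have hP' := coeff_eq_neg_star_mul hS h hX
  obtain ⟨M, hM⟩ : ∃ M, S + P * X = M := ⟨_, rfl⟩
  rw [hM] at hP hP' ⊢
  rw [eq_sub_of_add_eq hM, hP, hP']
  simp only [star_sub, star_one, star_smul, sub_mul, mul_sub, one_mul, mul_one, smul_mul_assoc,
    mul_smul_comm, smul_sub, smul_smul, smul_neg, neg_mul, mul_star_eq_one_of_norm_eq_one hζ,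
    one_smul]
  abel

end SmallSolution

/-! ### Stein equations -/

section Stein

variable {R : Type*} [NormedRing R] [StarRing R] [NormedAlgebra ℂ R]

/-- The Stein operator `Z ↦ Z - X⋆ Z X`. -/
def stein (X : R) : R →ₗ[ℂ] R where
  toFun Z := Z - star X * Z * X
  map_add' Y Z := by noncomm_ring
  map_smul' c Z := by simp [smul_sub]

theorem stein_apply (X Z : R) : stein X Z = Z - star X * Z * X := rfl

theorem stein_star (X Z : R) : stein X (star Z) = star (stein X Z) := by
  simp [stein_apply, mul_assoc]

variable {X K : R}

/-- The boundary identity behind `Re g_j = ᵗh̄ A_j h`. -/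
theorem one_sub_smul_add_star [StarModule ℂ R] (hK : IsSelfAdjoint K) {ζ : ℂ} (hζ : ‖ζ‖ = 1) :
    (1 - ζ) • (star (1 - ζ • X) * K * (1 - X)) +
        star ((1 - ζ) • (star (1 - ζ • X) * K * (1 - X))) =
      ((1 - ζ) * star (1 - ζ)) • stein X K := by
  have hz : ζ * star ζ = 1 := mul_star_eq_one_of_norm_eq_one hζ
  simp only [stein_apply, star_smul, star_mul, star_sub, star_one, star_star, hK.star_eq, sub_mul,
    mul_sub, one_mul, mul_one, smul_mul_assoc, mul_assoc]
  match_scalars <;> first | linear_combination hz | linear_combination -hz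

variable [NormedStarGroup R]

theorem stein_injective (hX : ‖X‖ < 1) : Function.Injective (stein X) := by
  refine (injective_iff_map_eq_zero _).2 fun Z hZ => ?_
  exact eq_zero_of_eq_mul_mul (by rwa [norm_star]) hX (sub_eq_zero.1 hZ)

theorem stein_surjective [FiniteDimensional ℂ R] (hX : ‖X‖ < 1) :
    Function.Surjective (stein X) :=
  LinearMap.injective_iff_surjective.1 (stein_injective hX)

theorem isSelfAdjoint_of_stein (hX : ‖X‖ < 1) (hK : IsSelfAdjoint (stein X K)) :
    IsSelfAdjoint K :=
  stein_injective hX (by rw [stein_star, hK.star_eq])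

end Stein

theorem isUnit_one_sub_smul {R : Type*} [NormedRing R] [HasSummableGeomSeries R]
    [NormedAlgebra ℂ R] {X : R} (hX : ‖X‖ < 1) {ζ : ℂ} (hζ : ‖ζ‖ ≤ 1) : IsUnit (1 - ζ • X) := by
  refine isUnit_one_sub_of_norm_lt_one ((norm_smul_le ζ X).trans_lt ?_)
  exact (mul_le_of_le_one_left (norm_nonneg _) hζ).trans_lt hX

/-! ### Smoothness of matrix operations -/

section MatrixCalculus

open scoped Matrix.Norms.L2Operator

variable {𝕜 m n : Type*} [RCLike 𝕜] [Fintype m] [Fintype n] [DecidableEq n] {k : WithTop ℕ∞}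

theorem contDiff_mulVec : ContDiff 𝕜 k fun p : Matrix m n 𝕜 × (n → 𝕜) => p.1 *ᵥ p.2 := by
  let B : Matrix m n 𝕜 →ₗ[𝕜] (n → 𝕜) →ₗ[𝕜] m → 𝕜 := Matrix.mulVecBilin 𝕜 𝕜
  exact B.toContinuousBilinearMap.isBoundedBilinearMap.contDiff

theorem contDiff_vecMul : ContDiff 𝕜 k fun p : (m → 𝕜) × Matrix m n 𝕜 => p.1 ᵥ* p.2 := by
  let B : (m → 𝕜) →ₗ[𝕜] Matrix m n 𝕜 →ₗ[𝕜] n → 𝕜 := Matrix.vecMulBilin 𝕜 𝕜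
  exact B.toContinuousBilinearMap.isBoundedBilinearMap.contDiff

end MatrixCalculus

section MatrixEquation

open scoped Matrix.Norms.L2Operator

variable {n d : ℕ}

theorem coeffP_conjTranspose {A : Fin d → Matrix (Fin n) (Fin n) ℂ}
    (hA : ∀ j, (A j).IsHermitian) (a : Fin d → ℂ) :
    (coeffP A a)ᴴ = ∑ j, star (a j) • A j := by
  simp [coeffP, Matrix.conjTranspose_sum, (hA _).eq]

theorem coeffA_isHermitian {A : Fin d → Matrix (Fin n) (Fin n) ℂ}
    (hA : ∀ j, (A j).IsHermitian) (b : Fin d → ℝ) (a : Fin d → ℂ) :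
    (coeffA A b a).IsHermitian := by
  rw [Matrix.IsHermitian, coeffA, Matrix.conjTranspose_sum]
  refine Finset.sum_congr rfl fun j _ => ?_
  rw [Matrix.conjTranspose_smul, (hA j).eq]
  congr 1
  simp only [star_sub, RCLike.star_def, Complex.conj_ofReal, Complex.conj_conj]
  ring

/-- The Hermitian middle factor `A + P X` of the factorization
`∑ c_j(ζ) A_j = (1 - ζX)⋆ (A + P X) (1 - ζX)` on the unit circle. -/
def middleFactor (A : Fin d → Matrix (Fin n) (Fin n) ℂ) (b : Fin d → ℝ) (a : Fin d → ℂ)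
    (X : Matrix (Fin n) (Fin n) ℂ) : Matrix (Fin n) (Fin n) ℂ :=
  coeffA A b a + coeffP A a * X

/-- `X` solves the matrix equation, `‖X‖ < 1`, and `A + P X` is invertible; for Hermitian `A_j`
this makes `X` the small solution. -/
structure IsRegularSolution (A : Fin d → Matrix (Fin n) (Fin n) ℂ) (b : Fin d → ℝ)
    (a : Fin d → ℂ) (X : Matrix (Fin n) (Fin n) ℂ) : Prop where
  eq : coeffP A a * X ^ 2 + coeffA A b a * X + (coeffP A a)ᴴ = 0
  norm_lt : ‖X‖ < 1
  isUnit : IsUnit (middleFactor A b a X)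

variable {A : Fin d → Matrix (Fin n) (Fin n) ℂ} {b : Fin d → ℝ} {a : Fin d → ℂ}
  {X : Matrix (Fin n) (Fin n) ℂ}

/-- The real functions `c_j` on the circle of the lift with parameter `a`. -/
def boundaryCoeff (b : Fin d → ℝ) (a : Fin d → ℂ) (j : Fin d) (ζ : ℂ) : ℝ :=
  (a j * star ζ + ((b j : ℂ) - a j - star (a j)) + star (a j) * ζ).re

theorem ofReal_boundaryCoeff (b : Fin d → ℝ) (a : Fin d → ℂ) (j : Fin d) (ζ : ℂ) :
    (boundaryCoeff b a j ζ : ℂ) =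
      a j * star ζ + ((b j : ℂ) - a j - star (a j)) + star (a j) * ζ := by
  rw [boundaryCoeff, ← Complex.conj_eq_iff_re]
  simp only [map_add, map_sub, map_mul, RCLike.star_def, Complex.conj_conj, Complex.conj_ofReal]
  ring

namespace IsRegularSolution

theorem isSmallSolution (h : IsRegularSolution A b a X) (hA : ∀ j, (A j).IsHermitian) :
    IsSmallSolution A b a X :=
  ⟨⟨h.eq, h.norm_lt⟩, fun _ hY hY' =>
    small_solution_unique (coeffA_isHermitian hA b a) h.eq h.norm_lt h.isUnit hY hY'⟩

theorem middleFactor_isHermitian (h : IsRegularSolution A b a X)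
    (hA : ∀ j, (A j).IsHermitian) : (middleFactor A b a X).IsHermitian :=
  isSelfAdjoint_add_mul (coeffA_isHermitian hA b a) h.eq h.norm_lt

theorem sum_boundaryCoeff_smul (h : IsRegularSolution A b a X) (hA : ∀ j, (A j).IsHermitian)
    {ζ : ℂ} (hζ : ‖ζ‖ = 1) : ∑ j, (boundaryCoeff b a j ζ : ℂ) • A j =
      (1 - ζ • X)ᴴ * middleFactor A b a X * (1 - ζ • X) := by
  refine Eq.trans ?_
    (star_one_sub_smul_mul_mul (coeffA_isHermitian hA b a) h.eq h.norm_lt hζ).symm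
  rw [Matrix.star_eq_conjTranspose, coeffP_conjTranspose hA]
  simp only [coeffP, coeffA, ofReal_boundaryCoeff, Finset.smul_sum, smul_smul,
    ← Finset.sum_add_distrib, ← add_smul, mul_comm]

theorem pencil_eq (h : IsRegularSolution A b a X) (hA : ∀ j, (A j).IsHermitian) :
    pencil A b = (1 - X)ᴴ * middleFactor A b a X * (1 - X) := by
  have hb : ∀ j, boundaryCoeff b a j 1 = b j := fun j => by simp [boundaryCoeff]
  simpa only [pencil, hb, one_smul] using h.sum_boundaryCoeff_smul hA norm_one

end IsRegularSolution

end MatrixEquation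

/-! ### The lift with given parameters -/

section Lift

open scoped Matrix.Norms.L2Operator

variable {n d : ℕ}

theorem differentiableAt_one_sub_smul (X : Matrix (Fin n) (Fin n) ℂ) (ζ : ℂ) :
    DifferentiableAt ℂ (fun z : ℂ => 1 - z • X) ζ :=
  (differentiableAt_id.smul_const X).const_sub 1

theorem differentiableAt_resolvent {X : Matrix (Fin n) (Fin n) ℂ} (hX : ‖X‖ < 1) {ζ : ℂ}
    (hζ : ‖ζ‖ ≤ 1) : DifferentiableAt ℂ (fun z : ℂ => (1 - z • X)⁻¹) ζ := by
  simp_rw [Matrix.nonsing_inv_eq_ringInverse]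
  exact (differentiableAt_inverse (isUnit_one_sub_smul hX hζ)).comp ζ
    (differentiableAt_one_sub_smul X ζ)

theorem differentiableAt_resolvent_mulVec {X : Matrix (Fin n) (Fin n) ℂ} (hX : ‖X‖ < 1)
    (v : Fin n → ℂ) {ζ : ℂ} (hζ : ‖ζ‖ ≤ 1) :
    DifferentiableAt ℂ (fun z : ℂ => (1 - z • X)⁻¹ *ᵥ v) ζ :=
  contDiff_mulVec.differentiable_one.differentiableAt.comp ζ
    ((differentiableAt_resolvent hX hζ).prodMk (differentiableAt_const v))

theorem differentiable_dotProduct_mulVec (w : Fin n → ℂ) (M : Matrix (Fin n) (Fin n) ℂ) :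
    Differentiable ℂ fun v : Fin n → ℂ => w ⬝ᵥ M *ᵥ v := by
  simp_rw [Matrix.dotProduct_mulVec]
  unfold dotProduct
  fun_prop

theorem differentiable_vecMul_one_sub_smul (w : Fin n → ℂ) (M X : Matrix (Fin n) (Fin n) ℂ) :
    Differentiable ℂ fun z : ℂ => w ᵥ* (M * (1 - z • X)) := fun z =>
  contDiff_vecMul.differentiable_one.differentiableAt.comp z
    ((differentiableAt_const w).prodMk ((differentiableAt_one_sub_smul X z).const_mul M))

theorem hasDerivAt_one_sub_smul {E : Type*} [NormedAddCommGroup E] [NormedSpace ℂ E] {f : ℂ → E}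
    (hf : DifferentiableAt ℂ f 1) : HasDerivAt (fun z => (1 - z) • f z) (-(f 1)) 1 := by
  have hsub : HasDerivAt (fun z : ℂ => 1 - z) (-1) 1 := (hasDerivAt_id (1 : ℂ)).const_sub 1
  exact (hsub.smul hf.hasDerivAt).congr_deriv (by simp)

/-- The components `(h, g, h̃, g̃)` of the lift with parameters `(a, V)`, written with the solution
`X` of the matrix equation and the solutions `K_j` of the Stein equations
`K_j - ᵗX̄ K_j X = A_j`. -/
def liftFun (A : Fin d → Matrix (Fin n) (Fin n) ℂ) (b : Fin d → ℝ) (a : Fin d → ℂ)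
    (X : Matrix (Fin n) (Fin n) ℂ) (K : Fin d → Matrix (Fin n) (Fin n) ℂ) (V : Fin n → ℂ)
    (ζ : ℂ) : CRSpace n d × CRSpace n d :=
  (((1 - ζ) • ((1 - ζ • X)⁻¹ *ᵥ ((1 - X) *ᵥ V)),
    fun j => (1 - ζ) • (2 * (star ((1 - X) *ᵥ V) ⬝ᵥ
      (K j * (1 - X)) *ᵥ ((1 - ζ • X)⁻¹ *ᵥ ((1 - X) *ᵥ V))))),
   ((1 - ζ) • (star ((1 - X) *ᵥ V) ᵥ* (middleFactor A b a X * (1 - ζ • X))),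
    fun j => (a j + ((b j : ℂ) - a j - star (a j)) * ζ + star (a j) * ζ ^ 2) / 2))

variable {A : Fin d → Matrix (Fin n) (Fin n) ℂ} {b : Fin d → ℝ} {a : Fin d → ℂ}
  {X : Matrix (Fin n) (Fin n) ℂ} {K : Fin d → Matrix (Fin n) (Fin n) ℂ} {V : Fin n → ℂ}

theorem liftFun_differentiableAt (hX : ‖X‖ < 1) {ζ : ℂ} (hζ : ‖ζ‖ ≤ 1) :
    DifferentiableAt ℂ (liftFun A b a X K V) ζ := by
  have hsub : DifferentiableAt ℂ (fun z : ℂ => 1 - z) ζ := differentiableAt_id.const_sub 1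
  have hR := differentiableAt_resolvent_mulVec hX ((1 - X) *ᵥ V) hζ
  refine ((hsub.smul hR).prodMk (differentiableAt_pi.2 fun j => hsub.smul ?_)).prodMk
    ((hsub.smul (differentiable_vecMul_one_sub_smul _ _ X ζ)).prodMk (by fun_prop))
  exact ((differentiable_dotProduct_mulVec _ _ _).comp ζ hR).const_mul 2

theorem liftFun_hasDerivAt_one (hX : ‖X‖ < 1) :
    HasDerivAt (liftFun A b a X K V)
      ((-V, fun j => -(2 * (star ((1 - X) *ᵥ V) ⬝ᵥ K j *ᵥ ((1 - X) *ᵥ V)))),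
       (-(star ((1 - X) *ᵥ V) ᵥ* (middleFactor A b a X * (1 - X))),
        fun j => ((b j : ℂ) - a j + star (a j)) / 2)) 1 := by
  have hR := differentiableAt_resolvent_mulVec hX ((1 - X) *ᵥ V) norm_one.le
  have hu : (1 - X)⁻¹ *ᵥ ((1 - X) *ᵥ V) = V := by
    rw [Matrix.mulVec_mulVec, Matrix.nonsing_inv_mul _
      ((Matrix.isUnit_iff_isUnit_det _).1 (isUnit_one_sub_of_norm_lt_one hX)), Matrix.one_mulVec]
  refine (HasDerivAt.prodMk ?_ (hasDerivAt_pi.2 fun j => ?_)).prodMk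
    (HasDerivAt.prodMk ?_ (hasDerivAt_pi.2 fun j => ?_))
  · simpa only [one_smul, hu] using hasDerivAt_one_sub_smul hR
  · have hg := hasDerivAt_one_sub_smul (((differentiable_dotProduct_mulVec
      (star ((1 - X) *ᵥ V)) (K j * (1 - X)) _).comp 1 hR).const_mul 2)
    refine hg.congr_deriv ?_
    rw [Function.comp_apply, one_smul, hu, Matrix.mulVec_mulVec]
  · simpa only [one_smul] using hasDerivAt_one_sub_smul
      (differentiable_vecMul_one_sub_smul (star ((1 - X) *ᵥ V)) (middleFactor A b a X) X 1)
  · have hquad := (((hasDerivAt_id (1 : ℂ)).const_mul ((b j : ℂ) - a j - star (a j))).const_add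
      (a j)).add (((hasDerivAt_id (1 : ℂ)).pow 2).const_mul (star (a j)))
    refine (hquad.div_const 2).congr_deriv ?_
    simp only [mul_one, Nat.cast_ofNat, Nat.add_one_sub_one, one_pow, id]
    ring

theorem liftFun_apply_one :
    liftFun A b a X K V 1 = ((0, 0), (0, fun j => (b j : ℂ) / 2)) := by
  simp only [liftFun, sub_self, zero_smul, mul_one, one_pow]
  congr! 3
  ring

theorem liftFun_apply_zero_fst_fst : (liftFun A b a X K V 0).1.1 = (1 - X) *ᵥ V := by
  simp [liftFun]

theorem liftFun_apply_zero_snd_snd (j : Fin d) : (liftFun A b a X K V 0).2.2 j = a j / 2 := by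
  simp [liftFun]

theorem star_dotProduct_mulVec (v w : Fin n → ℂ) (M : Matrix (Fin n) (Fin n) ℂ) :
    star (star v ⬝ᵥ M *ᵥ w) = star w ⬝ᵥ Mᴴ *ᵥ v := by
  rw [Matrix.star_dotProduct, star_star, Matrix.star_mulVec, Matrix.dotProduct_mulVec,
    dotProduct_comm]

theorem re_two_mul_star_dotProduct_mulVec (v : Fin n → ℂ) (M : Matrix (Fin n) (Fin n) ℂ) :
    (2 * (star v ⬝ᵥ M *ᵥ v)).re = (star v ⬝ᵥ (M + star M) *ᵥ v).re := by
  rw [Matrix.star_eq_conjTranspose, Matrix.add_mulVec, dotProduct_add, ← star_dotProduct_mulVec,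
    Complex.add_re, RCLike.star_def, Complex.conj_re, two_mul, Complex.add_re]

theorem liftFun_fst_mem_quadric (hA : ∀ j, (A j).IsHermitian) (hX : ‖X‖ < 1)
    (hK : ∀ j, stein X (K j) = A j) {ζ : ℂ} (hζ : ‖ζ‖ = 1) :
    (liftFun A b a X K V ζ).1 ∈ quadric A := by
  intro j
  have hKj : IsSelfAdjoint (K j) := isSelfAdjoint_of_stein hX ((hK j).symm ▸ hA j)
  simp only [liftFun]
  set W := (1 - X) *ᵥ V
  set u := (1 - ζ • X)⁻¹ *ᵥ W with hu
  have hWu : W = (1 - ζ • X) *ᵥ u := by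
    rw [hu, Matrix.mulVec_mulVec, Matrix.mul_nonsing_inv _
      ((Matrix.isUnit_iff_isUnit_det _).1 (isUnit_one_sub_smul hX hζ.le)), Matrix.one_mulVec]
  have hg : (1 - ζ) • (2 * (star W ⬝ᵥ (K j * (1 - X)) *ᵥ u)) =
      2 * (star u ⬝ᵥ ((1 - ζ) • (star (1 - ζ • X) * K j * (1 - X))) *ᵥ u) := by
    rw [hWu, Matrix.star_mulVec, ← Matrix.dotProduct_mulVec, Matrix.mulVec_mulVec,
      Matrix.smul_mulVec, dotProduct_smul, mul_assoc, Matrix.star_eq_conjTranspose]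
    simp only [smul_eq_mul]
    ring
  calc _ = (star u ⬝ᵥ (((1 - ζ) * star (1 - ζ)) • A j) *ᵥ u).re := by
        rw [hg, ← hK j, ← one_sub_smul_add_star hKj hζ, re_two_mul_star_dotProduct_mulVec]
    _ = _ := by
        rw [star_smul, Matrix.mulVec_smul, Matrix.smul_mulVec, smul_dotProduct, dotProduct_smul,
          dotProduct_smul, smul_smul, mul_comm]

end Lift

/-! ### Classification of the pointed lifts -/

section Classification

open Metric
open scoped Matrix.Norms.L2Operator

variable {n d : ℕ} {A : Fin d → Matrix (Fin n) (Fin n) ℂ} {b : Fin d → ℝ} {a : Fin d → ℂ}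
  {X : Matrix (Fin n) (Fin n) ℂ} {K : Fin d → Matrix (Fin n) (Fin n) ℂ} {V : Fin n → ℂ}

theorem sum_smul_delR (hA : ∀ j, (A j).IsHermitian) (c : Fin d → ℝ) (p : CRSpace n d) :
    ∑ j, c j • delR A j p = (-(star p.1 ᵥ* ∑ j, (c j : ℂ) • A j), fun j => (c j : ℂ) / 2) := by
  simp_rw [fun j => delR_eq A j (hA j) p]
  refine Prod.ext ?_ (funext fun k => ?_)
  · simp only [Prod.fst_sum, Prod.smul_mk, Matrix.vecMul_sum, Matrix.vecMul_smul, smul_neg,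
      Finset.sum_neg_distrib, Complex.coe_smul]
  · simp [Prod.snd_sum, Finset.sum_apply, Pi.single_apply, div_eq_mul_inv]

theorem discExtend_of_mem (F : DiscMap n d) {ζ : ℂ} (h : ζ ∈ closedBall (0 : ℂ) 1) :
    discExtend F ζ = F ⟨ζ, h⟩ :=
  dif_pos h

theorem discExtend_coe (F : DiscMap n d) (ζ : closedBall (0 : ℂ) 1) : discExtend F ζ = F ζ :=
  discExtend_of_mem F ζ.2

theorem diffContOnCl_discExtend {F : DiscMap n d}
    (h : DifferentiableOn ℂ (discExtend F) (ball 0 1)) :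
    DiffContOnCl ℂ (discExtend F) (ball 0 1) := by
  refine ⟨h, ?_⟩
  rw [closure_ball _ one_ne_zero, continuousOn_iff_continuous_domRestrict]
  exact F.continuous.congr fun ζ => (discExtend_coe F ζ).symm

/-- The disc map with components `liftFun`. -/
def liftMap (A : Fin d → Matrix (Fin n) (Fin n) ℂ) (b : Fin d → ℝ) (a : Fin d → ℂ)
    (X : Matrix (Fin n) (Fin n) ℂ) (hX : ‖X‖ < 1) (K : Fin d → Matrix (Fin n) (Fin n) ℂ)
    (V : Fin n → ℂ) : DiscMap n d where
  toFun ζ := liftFun A b a X K V ζ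
  continuous_toFun := continuous_iff_continuousAt.2 fun ζ =>
    (liftFun_differentiableAt hX (mem_closedBall_zero_iff.1 ζ.2)).continuousAt.comp
      continuous_subtype_val.continuousAt

theorem discExtend_liftMap (hX : ‖X‖ < 1) :
    Set.EqOn (discExtend (liftMap A b a X hX K V)) (liftFun A b a X K V) (closedBall 0 1) :=
  fun _ hζ => discExtend_of_mem _ hζ

theorem liftMap_hasDerivWithinAt_one (hX : ‖X‖ < 1) :
    HasDerivWithinAt (discExtend (liftMap A b a X hX K V))
      ((-V, fun j => -(2 * (star ((1 - X) *ᵥ V) ⬝ᵥ K j *ᵥ ((1 - X) *ᵥ V)))),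
       (-(star ((1 - X) *ᵥ V) ᵥ* (middleFactor A b a X * (1 - X))),
        fun j => ((b j : ℂ) - a j + star (a j)) / 2)) (closedBall 0 1) 1 :=
  (liftFun_hasDerivAt_one hX).hasDerivWithinAt.congr (discExtend_liftMap hX)
    (discExtend_liftMap hX (by simp))

theorem liftFun_snd (hA : ∀ j, (A j).IsHermitian) (h : IsRegularSolution A b a X) {ζ : ℂ}
    (hζ : ‖ζ‖ = 1) : (liftFun A b a X K V ζ).2 =
      ζ • ∑ j, boundaryCoeff b a j ζ • delR A j (liftFun A b a X K V ζ).1 := by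
  have hz := mul_star_eq_one_of_norm_eq_one hζ
  have hu : star ((1 - ζ • X)⁻¹ *ᵥ ((1 - X) *ᵥ V)) ᵥ* (1 - ζ • X)ᴴ = star ((1 - X) *ᵥ V) := by
    rw [← Matrix.star_mulVec, Matrix.mulVec_mulVec, Matrix.mul_nonsing_inv _
      ((Matrix.isUnit_iff_isUnit_det _).1 (isUnit_one_sub_smul h.norm_lt hζ.le)), Matrix.one_mulVec]
  rw [sum_smul_delR hA, h.sum_boundaryCoeff_smul hA hζ]
  refine Prod.ext ?_ (funext fun j => ?_)
  · simp only [liftFun, Prod.smul_fst, star_smul]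
    rw [Matrix.smul_vecMul, mul_assoc, ← Matrix.vecMul_vecMul _ ((1 - ζ • X)ᴴ), hu, smul_neg,
      smul_smul, ← neg_smul]
    congr 1
    simp only [star_sub, star_one]
    linear_combination -hz
  · simp only [liftFun, Prod.smul_snd, Pi.smul_apply, ofReal_boundaryCoeff, smul_eq_mul]
    linear_combination -(a j) / 2 * hz

theorem liftMap_fst_nonconstant (hX : ‖X‖ < 1) (hV : V ≠ 0) :
    ¬ ∃ p, ∀ ζ, (liftMap A b a X hX K V ζ).1 = p := by
  rintro ⟨p, hp⟩
  have h01 : (liftFun A b a X K V 0).1.1 = (liftFun A b a X K V 1).1.1 :=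
    congrArg Prod.fst ((hp ⟨0, by simp⟩).trans (hp ⟨1, by simp⟩).symm)
  rw [liftFun_apply_zero_fst_fst, liftFun_apply_one] at h01
  exact hV (Matrix.mulVec_injective_of_isUnit (isUnit_one_sub_of_norm_lt_one hX)
    (h01.trans (Matrix.mulVec_zero _).symm))

theorem sum_boundaryCoeff_smul_delR_ne_zero (hA : ∀ j, (A j).IsHermitian)
    (h : IsRegularSolution A b a X) [NeZero n] {ζ : ℂ} (hζ : ‖ζ‖ = 1) :
    ∑ j, boundaryCoeff b a j ζ • delR A j 0 ≠ 0 := by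
  rw [sum_smul_delR hA]
  intro h0
  have hc : ∀ j, (boundaryCoeff b a j ζ : ℂ) = 0 := fun j => by
    simpa using congrFun (congrArg Prod.snd h0) j
  have hfac := h.sum_boundaryCoeff_smul hA hζ
  simp only [hc, zero_smul, Finset.sum_const_zero] at hfac
  have hu := isUnit_one_sub_smul h.norm_lt hζ.le
  exact ((hu.star.mul h.isUnit).mul hu).ne_zero hfac.symm

theorem liftMap_mem_pointedLifts (hA : ∀ j, (A j).IsHermitian) (h : IsRegularSolution A b a X)
    (hK : ∀ j, stein X (K j) = A j) (hV : V ≠ 0) :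
    liftMap A b a X h.norm_lt K V ∈ pointedLifts A b := by
  have hX := h.norm_lt
  have : NeZero n := ⟨by rintro rfl; exact hV (Subsingleton.elim _ _)⟩
  refine ⟨⟨?_, liftMap_fst_nonconstant hX hV, fun ζ hζ => liftFun_fst_mem_quadric hA hX hK hζ,
    boundaryCoeff b a, fun ζ hζ =>
      ⟨sum_boundaryCoeff_smul_delR_ne_zero hA h hζ, liftFun_snd hA h hζ⟩⟩, ?_⟩
  · refine DifferentiableOn.congr (f := liftFun A b a X K V) (fun ζ hζ => ?_)
      ((discExtend_liftMap hX).mono ball_subset_closedBall)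
    exact (liftFun_differentiableAt hX (mem_ball_zero_iff.1 hζ).le).differentiableWithinAt
  · rw [discExtend_liftMap hX (by simp), liftFun_apply_one]

theorem ofReal_coeff_eq_of_snd_eq (hA : ∀ j, (A j).IsHermitian) {p : CRSpace n d × CRSpace n d}
    {ζ : ℂ} (hζ : ‖ζ‖ = 1) {c : Fin d → ℝ} (h : p.2 = ζ • ∑ j, c j • delR A j p.1) (j : Fin d) :
    (c j : ℂ) = 2 * star ζ * p.2.2 j := by
  rw [sum_smul_delR hA] at h
  have hj : p.2.2 j = ζ * (c j / 2) := congrFun (congrArg Prod.snd h) j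
  rw [hj]
  linear_combination -(c j : ℂ) * mul_star_eq_one_of_norm_eq_one hζ

theorem pointedLifts_snd_fst_unique (hA : ∀ j, (A j).IsHermitian) {F G : DiscMap n d}
    (hF : F ∈ pointedLifts A b) (hG : G ∈ pointedLifts A b)
    (hh : ∀ ζ, (F ζ).1.1 = (G ζ).1.1) (hg : ∀ ζ, (F ζ).2.2 = (G ζ).2.2)
    (ζ : closedBall (0 : ℂ) 1) : (F ζ).2.1 = (G ζ).2.1 := by
  obtain ⟨⟨hFd, -, -, cF, hcF⟩, -⟩ := hF
  obtain ⟨⟨hGd, -, -, cG, hcG⟩, -⟩ := hG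
  have hd : Differentiable ℂ fun p : CRSpace n d × CRSpace n d => p.2.1 := by fun_prop
  have heq := Complex.eqOn_closure_of_eqOn_frontier isBounded_ball
    (hd.comp_diffContOnCl (diffContOnCl_discExtend hFd))
    (hd.comp_diffContOnCl (diffContOnCl_discExtend hGd)) fun z hz => ?_
  · rw [closure_ball _ one_ne_zero] at heq
    simpa only [Function.comp_apply, discExtend_coe] using heq ζ.2
  rw [frontier_ball _ one_ne_zero, mem_sphere_zero_iff_norm] at hz
  have hz' : z ∈ closedBall (0 : ℂ) 1 := mem_closedBall_zero_iff.2 hz.le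
  have eF := (hcF ⟨z, hz'⟩ hz).2
  have eG := (hcG ⟨z, hz'⟩ hz).2
  have hc : ∀ j, (cF j z : ℂ) = cG j z := fun j => by
    rw [ofReal_coeff_eq_of_snd_eq hA hz eF, ofReal_coeff_eq_of_snd_eq hA hz eG, hg]
  simp only [Function.comp_apply, discExtend_of_mem _ hz']
  rw [eF, eG, sum_smul_delR hA, sum_smul_delR hA, hh]
  simp only [hc, Prod.smul_fst]

theorem pointedLifts_fst_snd_unique {F G : DiscMap n d}
    (hF : F ∈ pointedLifts A b) (hG : G ∈ pointedLifts A b)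
    (hh : ∀ ζ, (F ζ).1.1 = (G ζ).1.1) (ζ : closedBall (0 : ℂ) 1) : (F ζ).1.2 = (G ζ).1.2 := by
  obtain ⟨⟨hFd, -, hFq, -⟩, hF1⟩ := hF
  obtain ⟨⟨hGd, -, hGq, -⟩, hG1⟩ := hG
  ext j
  have hd : Differentiable ℂ fun p : CRSpace n d × CRSpace n d => p.1.2 j := by fun_prop
  have heq := eq_of_re_eq_on_circle (hd.comp_diffContOnCl (diffContOnCl_discExtend hFd))
    (hd.comp_diffContOnCl (diffContOnCl_discExtend hGd)) (fun z hz => ?_)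
    (by simp only [Function.comp_apply, hF1, hG1]) ζ.2
  · simpa only [Function.comp_apply, discExtend_coe] using heq
  have hz' : z ∈ closedBall (0 : ℂ) 1 := mem_closedBall_zero_iff.2 hz.le
  simp only [Function.comp_apply, discExtend_of_mem _ hz']
  rw [hFq ⟨z, hz'⟩ hz j, hGq ⟨z, hz'⟩ hz j, hh]

theorem pointedLifts_ext (hA : ∀ j, (A j).IsHermitian) {F G : DiscMap n d}
    (hF : F ∈ pointedLifts A b) (hG : G ∈ pointedLifts A b)
    (hh : ∀ ζ, (F ζ).1.1 = (G ζ).1.1) (hg : ∀ ζ, (F ζ).2.2 = (G ζ).2.2) : F = G :=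
  ContinuousMap.ext fun ζ =>
    Prod.ext (Prod.ext (hh ζ) (pointedLifts_fst_snd_unique hF hG hh ζ))
      (Prod.ext (pointedLifts_snd_fst_unique hA hF hG hh hg ζ) (hg ζ))

theorem pointedLifts_snd_snd_eq (hA : ∀ j, (A j).IsHermitian) {F : DiscMap n d}
    (hF : F ∈ pointedLifts A b) (ha : ∀ j, a j = 2 * (discExtend F 0).2.2 j)
    (ζ : closedBall (0 : ℂ) 1) (j : Fin d) :
    (F ζ).2.2 j = (a j + ((b j : ℂ) - a j - star (a j)) * ζ + star (a j) * (ζ : ℂ) ^ 2) / 2 := by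
  obtain ⟨⟨hFd, -, -, c, hc⟩, hF1⟩ := hF
  have hd : Differentiable ℂ fun p : CRSpace n d × CRSpace n d => 2 * p.2.2 j := by fun_prop
  have hquad := eq_quadratic_of_eq_mul_real_on_circle (c := c j)
    (hd.comp_diffContOnCl (diffContOnCl_discExtend hFd)) (fun z hz => ?_) ζ.2
  · simp only [Function.comp_apply, ← ha, discExtend_coe, hF1] at hquad
    linear_combination hquad / 2
  have hz' : z ∈ closedBall (0 : ℂ) 1 := mem_closedBall_zero_iff.2 hz.le
  simp only [Function.comp_apply, discExtend_of_mem _ hz']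
  rw [ofReal_coeff_eq_of_snd_eq hA hz (hc ⟨z, hz'⟩ hz).2 j]
  linear_combination -2 * (F ⟨z, hz'⟩).2.2 j * mul_star_eq_one_of_norm_eq_one hz

theorem middleFactor_mulVec_eq_mul_star (hA : ∀ j, (A j).IsHermitian)
    (h : IsRegularSolution A b a X) {p : CRSpace n d × CRSpace n d} {ζ : ℂ} (hζ : ‖ζ‖ = 1)
    (hp : p.2 = ζ • ∑ j, boundaryCoeff b a j ζ • delR A j p.1) (k : Fin n) :
    ((middleFactor A b a X * (1 - ζ • X)) *ᵥ p.1.1) k =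
      ζ * star (-(p.2.1 ᵥ* (1 - ζ • X)⁻¹) k) := by
  have hu := (Matrix.isUnit_iff_isUnit_det _).1 (isUnit_one_sub_smul h.norm_lt hζ.le)
  have hl : p.2.1 ᵥ* (1 - ζ • X)⁻¹ =
      -(ζ • star ((middleFactor A b a X * (1 - ζ • X)) *ᵥ p.1.1)) := by
    rw [hp, sum_smul_delR hA, h.sum_boundaryCoeff_smul hA hζ, Prod.smul_fst, smul_neg,
      Matrix.neg_vecMul, Matrix.smul_vecMul, Matrix.vecMul_vecMul, mul_assoc,
      Matrix.mul_nonsing_inv _ hu, mul_one, Matrix.star_mulVec, Matrix.conjTranspose_mul,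
      (h.middleFactor_isHermitian hA).eq]
  simp only [hl, neg_neg, Pi.neg_apply, Pi.smul_apply, Pi.star_apply, smul_eq_mul, star_mul',
    star_star]
  linear_combination
    -((middleFactor A b a X * (1 - ζ • X)) *ᵥ p.1.1) k * mul_star_eq_one_of_norm_eq_one hζ

theorem diffContOnCl_middleFactor_mulVec {h : ℂ → Fin n → ℂ} (hh : DiffContOnCl ℂ h (ball 0 1))
    (Q X : Matrix (Fin n) (Fin n) ℂ) :
    DiffContOnCl ℂ (fun z => (Q * (1 - z • X)) *ᵥ h z) (ball 0 1) := by
  have hM : Differentiable ℂ fun z : ℂ => Q * (1 - z • X) := fun z =>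
    (differentiableAt_one_sub_smul X z).const_mul Q
  exact contDiff_mulVec.differentiable_one.comp_diffContOnCl
    ⟨hM.differentiableOn.prodMk hh.1, hM.continuous.continuousOn.prodMk hh.2⟩

theorem diffContOnCl_vecMul_resolvent {w : ℂ → Fin n → ℂ} (hw : DiffContOnCl ℂ w (ball 0 1))
    (hX : ‖X‖ < 1) : DiffContOnCl ℂ (fun z => w z ᵥ* (1 - z • X)⁻¹) (ball 0 1) := by
  refine contDiff_vecMul.differentiable_one.comp_diffContOnCl
    ⟨hw.1.prodMk fun z hz => ?_, hw.2.prodMk fun z hz => ?_⟩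
  · exact (differentiableAt_resolvent hX (mem_ball_zero_iff.1 hz).le).differentiableWithinAt
  · rw [closure_ball _ one_ne_zero, mem_closedBall_zero_iff] at hz
    exact (differentiableAt_resolvent hX hz).continuousAt.continuousWithinAt

theorem pointedLifts_snd_eq (hA : ∀ j, (A j).IsHermitian) {F : DiscMap n d}
    (hF : F ∈ pointedLifts A b) (ha : ∀ j, a j = 2 * (discExtend F 0).2.2 j)
    (ζ : closedBall (0 : ℂ) 1) (hζ : ‖(ζ : ℂ)‖ = 1) :
    (F ζ).2 = (ζ : ℂ) • ∑ j, boundaryCoeff b a j ζ • delR A j (F ζ).1 := by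
  obtain ⟨⟨-, -, -, c, hc⟩, -⟩ := id hF
  have hcb : ∀ j, c j ζ = boundaryCoeff b a j ζ := fun j => by
    rw [← Complex.ofReal_inj, ofReal_coeff_eq_of_snd_eq hA hζ (hc ζ hζ).2 j,
      pointedLifts_snd_snd_eq hA hF ha, ofReal_boundaryCoeff]
    linear_combination ((b j : ℂ) - a j - star (a j) + star (a j) * ζ) *
      mul_star_eq_one_of_norm_eq_one hζ
  simpa only [hcb] using (hc ζ hζ).2

theorem pointedLifts_fst_fst_eq (hA : ∀ j, (A j).IsHermitian) {F : DiscMap n d}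
    (hF : F ∈ pointedLifts A b) (ha : ∀ j, a j = 2 * (discExtend F 0).2.2 j)
    (h : IsRegularSolution A b a X) (ζ : closedBall (0 : ℂ) 1) :
    (F ζ).1.1 = (1 - (ζ : ℂ)) • ((1 - (ζ : ℂ) • X)⁻¹ *ᵥ (discExtend F 0).1.1) := by
  obtain ⟨⟨hFd, -⟩, hF1⟩ := id hF
  have hproj : ∀ k, Differentiable ℂ fun v : Fin n → ℂ => v k := fun k => by fun_prop
  have hu := diffContOnCl_middleFactor_mulVec ((differentiable_fst.comp
    differentiable_fst).comp_diffContOnCl (diffContOnCl_discExtend hFd)) (middleFactor A b a X) X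
  have hl := (diffContOnCl_vecMul_resolvent ((differentiable_fst.comp
    differentiable_snd).comp_diffContOnCl (diffContOnCl_discExtend hFd)) h.norm_lt).neg
  have haffine : middleFactor A b a X *ᵥ ((1 - (ζ : ℂ) • X) *ᵥ (F ζ).1.1) =
      middleFactor A b a X *ᵥ ((1 - (ζ : ℂ)) • (discExtend F 0).1.1) := by
    ext k
    have hk := eq_affine_of_eq_mul_star_on_circle ((hproj k).comp_diffContOnCl hu)
      ((hproj k).comp_diffContOnCl hl) (fun z hz => ?_) ζ.2
    · simp only [Function.comp_apply, discExtend_coe, hF1, zero_smul, sub_zero, mul_one,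
        Matrix.mulVec_zero, Pi.zero_apply] at hk
      rw [Matrix.mulVec_mulVec, hk, Matrix.mulVec_smul, Pi.smul_apply, smul_eq_mul]
      ring
    · have hz' : z ∈ closedBall (0 : ℂ) 1 := mem_closedBall_zero_iff.2 hz.le
      simp only [Function.comp_apply, Pi.neg_apply, discExtend_of_mem _ hz']
      exact middleFactor_mulVec_eq_mul_star hA h hz (pointedLifts_snd_eq hA hF ha ⟨z, hz'⟩ hz) k
  have hζu := (Matrix.isUnit_iff_isUnit_det _).1
    (isUnit_one_sub_smul h.norm_lt (mem_closedBall_zero_iff.1 ζ.2))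
  rw [← Matrix.mulVec_smul, ← Matrix.mulVec_injective_of_isUnit h.isUnit haffine,
    Matrix.mulVec_mulVec, Matrix.nonsing_inv_mul _ hζu, Matrix.one_mulVec]

theorem eq_liftMap_of_mem_pointedLifts (hA : ∀ j, (A j).IsHermitian) {F : DiscMap n d}
    (hF : F ∈ pointedLifts A b) (ha : ∀ j, a j = 2 * (discExtend F 0).2.2 j)
    (h : IsRegularSolution A b a X) (hK : ∀ j, stein X (K j) = A j) (hV₀ : V ≠ 0)
    (hV : (1 - X) *ᵥ V = (discExtend F 0).1.1) : liftMap A b a X h.norm_lt K V = F := by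
  refine pointedLifts_ext hA (liftMap_mem_pointedLifts hA h hK hV₀) hF (fun ζ => ?_) fun ζ => ?_
  · rw [pointedLifts_fst_fst_eq hA hF ha h, ← hV]
    rfl
  · ext j
    rw [pointedLifts_snd_snd_eq hA hF ha]
    rfl

end Classification

/-! ### The chart of the pointed lifts -/

section Chart

open Metric
open scoped Matrix.Norms.L2Operator ContDiff

variable {n d : ℕ} {A : Fin d → Matrix (Fin n) (Fin n) ℂ} {b : Fin d → ℝ}

theorem continuous_matrix_inv {T : Type*} [TopologicalSpace T] {M : T → Matrix (Fin n) (Fin n) ℂ}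
    (hM : Continuous M) (hu : ∀ t, IsUnit (M t)) : Continuous fun t => (M t)⁻¹ := by
  simp_rw [Matrix.nonsing_inv_eq_ringInverse]
  exact continuous_iff_continuousAt.2 fun t =>
    (NormedRing.inverse_continuousAt (hu t).unit).comp (f := M) hM.continuousAt

theorem contDiff_coeffP : ContDiff ℝ ω (coeffP A) := by
  unfold coeffP
  fun_prop

theorem contDiff_coeffA : ContDiff ℝ ω (coeffA A b) := by
  have hstar : ∀ j, ContDiff ℝ ω fun a : Fin d → ℂ => star (a j) := fun j =>
    (starL' ℝ : ℂ ≃L[ℝ] ℂ).contDiff.comp (contDiff_apply ℝ ℂ j)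
  unfold coeffA
  fun_prop

theorem continuous_liftFun {T : Type*} [TopologicalSpace T] {a : T → Fin d → ℂ}
    {X : T → Matrix (Fin n) (Fin n) ℂ} {K : T → Fin d → Matrix (Fin n) (Fin n) ℂ}
    {V : T → Fin n → ℂ} {ζ : T → ℂ} (ha : Continuous a) (hX : Continuous X) (hK : Continuous K)
    (hV : Continuous V) (hζ : Continuous ζ) (hu : ∀ t, IsUnit (1 - ζ t • X t)) :
    Continuous fun t => liftFun A b (a t) (X t) (K t) (V t) (ζ t) := by
  have hR : Continuous fun t => (1 - ζ t • X t)⁻¹ :=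
    continuous_matrix_inv (continuous_const.sub (hζ.smul hX)) hu
  have hQ : Continuous fun t => middleFactor A b (a t) (X t) :=
    (contDiff_coeffA.continuous.comp ha).add ((contDiff_coeffP.continuous.comp ha).mul hX)
  have hW : Continuous fun t => (1 - X t) *ᵥ V t := (continuous_const.sub hX).matrix_mulVec hV
  have hsub : Continuous fun t => 1 - ζ t := continuous_const.sub hζ
  have hKX : ∀ j, Continuous fun t => K t j * (1 - X t) := fun j =>
    ((continuous_apply j).comp hK).mul (continuous_const.sub hX)
  refine Continuous.prodMk (Continuous.prodMk ?_ (continuous_pi fun j => ?_))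
    (Continuous.prodMk ?_ (by fun_prop))
  · exact hsub.smul (hR.matrix_mulVec hW)
  · exact hsub.smul (continuous_const.mul
      (hW.star.dotProduct ((hKX j).matrix_mulVec (hR.matrix_mulVec hW))))
  · exact hsub.smul (hW.star.matrix_vecMul (hQ.mul (continuous_const.sub (hζ.smul hX))))

/-- An analytic family of regular solutions of the matrix equation, and of solutions of the
associated Stein equations, over an open set of parameters `a`. -/
structure SolutionFamily (A : Fin d → Matrix (Fin n) (Fin n) ℂ) (b : Fin d → ℝ) where
  base : Set (Fin d → ℂ)
  isOpen_base : IsOpen base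
  X : (Fin d → ℂ) → Matrix (Fin n) (Fin n) ℂ
  K : (Fin d → ℂ) → Fin d → Matrix (Fin n) (Fin n) ℂ
  contDiffOn_X : ContDiffOn ℝ ω X base
  contDiffOn_K : ContDiffOn ℝ ω K base
  isRegular : ∀ a ∈ base, IsRegularSolution A b a (X a)
  stein_eq : ∀ a ∈ base, ∀ j, stein (X a) (K a j) = A j

theorem continuous_discExtend_zero :
    Continuous fun F : pointedLifts A b => discExtend (F : DiscMap n d) 0 := by
  simp_rw [discExtend_of_mem _ (mem_closedBall_self zero_le_one : (0 : ℂ) ∈ closedBall 0 1)]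
  exact (continuous_eval_const _).comp continuous_subtype_val

namespace SolutionFamily

variable (S : SolutionFamily A b)

/-- The open set of parameters `(a, V)` with `a` in the base and `V ≠ 0`; for `V = 0` the disc
is constant. -/
def source : Set ((Fin d → ℂ) × (Fin n → ℂ)) := S.base ×ˢ {0}ᶜ

theorem isOpen_source : IsOpen S.source := S.isOpen_base.prod isOpen_compl_singleton

/-- The lift with given parameters in `S.source`. -/
def lift (q : S.source) : DiscMap n d :=
  liftMap A b q.1.1 (S.X q.1.1) (S.isRegular _ q.2.1).norm_lt (S.K q.1.1) q.1.2

theorem continuous_lift : Continuous S.lift := by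
  have ha : Continuous fun p : S.source × closedBall (0 : ℂ) 1 => p.1.1.1 := by fun_prop
  have hmem : ∀ p : S.source × closedBall (0 : ℂ) 1, p.1.1.1 ∈ S.base := fun p => p.1.2.1
  have hlift := continuous_liftFun (A := A) (b := b) ha
    (S.contDiffOn_X.continuousOn.comp_continuous ha hmem)
    (S.contDiffOn_K.continuousOn.comp_continuous ha hmem)
    (by fun_prop : Continuous fun p : S.source × closedBall (0 : ℂ) 1 => p.1.1.2)
    (by fun_prop : Continuous fun p : S.source × closedBall (0 : ℂ) 1 => (p.2 : ℂ))
    fun p => isUnit_one_sub_smul (S.isRegular _ (hmem p)).norm_lt (mem_closedBall_zero_iff.1 p.2.2)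
  exact (ContinuousMap.curry ⟨_, hlift⟩).continuous

/-- The parameters `(a, V)` of a pointed lift, read off from its value at `0`. -/
def params (F : pointedLifts A b) : (Fin d → ℂ) × (Fin n → ℂ) :=
  (fun j => 2 * (discExtend F.1 0).2.2 j,
   (1 - S.X fun j => 2 * (discExtend F.1 0).2.2 j)⁻¹ *ᵥ (discExtend F.1 0).1.1)

theorem continuous_params_fst : Continuous fun F : pointedLifts A b => (S.params F).1 := by
  have := continuous_discExtend_zero (A := A) (b := b)
  unfold params
  fun_prop

theorem isOpen_params_preimage_base : IsOpen {F : pointedLifts A b | (S.params F).1 ∈ S.base} :=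
  S.isOpen_base.preimage S.continuous_params_fst

theorem continuousOn_params :
    ContinuousOn S.params {F : pointedLifts A b | (S.params F).1 ∈ S.base} := by
  rw [continuousOn_iff_continuous_domRestrict]
  have ha : Continuous fun F : {F : pointedLifts A b | (S.params F).1 ∈ S.base} =>
      (S.params F.1).1 := S.continuous_params_fst.comp continuous_subtype_val
  have hX := S.contDiffOn_X.continuousOn.comp_continuous ha fun F => F.2
  have hh := (continuous_discExtend_zero (A := A) (b := b)).fst.fst.comp
    (continuous_subtype_val (p := fun F : pointedLifts A b => (S.params F).1 ∈ S.base))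
  exact ha.prodMk ((continuous_matrix_inv (continuous_const.sub hX) fun F =>
    isUnit_one_sub_of_norm_lt_one (S.isRegular _ F.2).norm_lt).matrix_mulVec hh)

theorem lift_mem (hA : ∀ j, (A j).IsHermitian) (q : S.source) : S.lift q ∈ pointedLifts A b :=
  liftMap_mem_pointedLifts hA (S.isRegular _ q.2.1) (S.stein_eq _ q.2.1) q.2.2

theorem params_lift (hA : ∀ j, (A j).IsHermitian) (q : S.source) :
    S.params ⟨S.lift q, S.lift_mem hA q⟩ = q := by
  have hX := (S.isRegular _ q.2.1).norm_lt
  have hu := (Matrix.isUnit_iff_isUnit_det _).1 (isUnit_one_sub_of_norm_lt_one hX)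
  have h0 : discExtend (S.lift q) 0 = _ := discExtend_liftMap hX (by simp)
  have ha : (fun j => 2 * (discExtend (S.lift q) 0).2.2 j) = q.1.1 := by
    ext j
    rw [h0, liftFun_apply_zero_snd_snd]
    ring
  refine Prod.ext ha ?_
  simp only [params]
  rw [ha, h0, liftFun_apply_zero_fst_fst, Matrix.mulVec_mulVec, Matrix.nonsing_inv_mul _ hu,
    Matrix.one_mulVec]

theorem lift_params (hA : ∀ j, (A j).IsHermitian) (F : pointedLifts A b)
    (hF : S.params F ∈ S.source) : S.lift ⟨S.params F, hF⟩ = F := by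
  have hu := (Matrix.isUnit_iff_isUnit_det _).1
    (isUnit_one_sub_of_norm_lt_one (S.isRegular _ hF.1).norm_lt)
  refine eq_liftMap_of_mem_pointedLifts hA F.2 (fun j => rfl) (S.isRegular _ hF.1)
    (S.stein_eq _ hF.1) hF.2 ?_
  simp only [params] at hu ⊢
  rw [Matrix.mulVec_mulVec, Matrix.mul_nonsing_inv _ hu, Matrix.one_mulVec]

open Classical in
/-- The chart of the space of pointed lifts given by the parameters; the lift of `q₀` is a junk
value outside the source. -/
def chart (hA : ∀ j, (A j).IsHermitian) (q₀ : S.source) :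
    OpenPartialHomeomorph ((Fin d → ℂ) × (Fin n → ℂ)) (pointedLifts A b) where
  toFun q := if h : q ∈ S.source then ⟨S.lift ⟨q, h⟩, S.lift_mem hA _⟩
    else ⟨S.lift q₀, S.lift_mem hA _⟩
  invFun := S.params
  source := S.source
  target := {F | S.params F ∈ S.source}
  map_source' q hq := by
    simpa only [dif_pos hq, Set.mem_ofPred_eq, S.params_lift hA ⟨q, hq⟩] using hq
  map_target' F hF := hF
  left_inv' q hq := by simpa only [dif_pos hq] using S.params_lift hA ⟨q, hq⟩
  right_inv' F hF := by
    simpa only [dif_pos (show S.params F ∈ S.source from hF)] using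
      Subtype.ext (S.lift_params hA F hF)
  open_source := S.isOpen_source
  open_target := by
    convert S.continuousOn_params.isOpen_inter_preimage S.isOpen_params_preimage_base
      S.isOpen_source using 1
    ext F
    exact ⟨fun h => ⟨h.1, h⟩, fun h => h.2⟩
  continuousOn_toFun := by
    rw [continuousOn_iff_continuous_domRestrict]
    refine (S.continuous_lift.subtype_mk (S.lift_mem hA)).congr fun q => ?_
    simp [Set.domRestrict]
  continuousOn_invFun := S.continuousOn_params.mono fun F hF => hF.1

theorem chart_apply (hA : ∀ j, (A j).IsHermitian) (q₀ : S.source)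
    {q : (Fin d → ℂ) × (Fin n → ℂ)} (hq : q ∈ S.source) :
    (S.chart hA q₀ q : DiscMap n d) = S.lift ⟨q, hq⟩ :=
  congrArg Subtype.val (dif_pos hq)

theorem hasParameters_chart (hA : ∀ j, (A j).IsHermitian) (q₀ : S.source)
    {q : (Fin d → ℂ) × (Fin n → ℂ)} (hq : q ∈ S.source) :
    HasParameters A b (S.chart hA q₀ q) q := by
  rw [S.chart_apply hA q₀ hq]
  exact ⟨S.X q.1, (S.isRegular _ hq.1).isSmallSolution hA, fun ζ => ⟨rfl, fun j => rfl⟩⟩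

/-- The `1`-jet map in the parameters `(a, V)`. -/
def jet (q : (Fin d → ℂ) × (Fin n → ℂ)) : (Fin n → ℂ) × (Fin d → ℝ) × (Fin d → ℝ) :=
  (-q.2, fun j => -2 * (star ((1 - S.X q.1) *ᵥ q.2) ⬝ᵥ
    S.K q.1 j *ᵥ ((1 - S.X q.1) *ᵥ q.2)).re, fun j => -(q.1 j).im)

theorem hasDerivWithinAt_chart (hA : ∀ j, (A j).IsHermitian) (q₀ : S.source)
    {q : (Fin d → ℂ) × (Fin n → ℂ)} (hq : q ∈ S.source) :
    HasDerivWithinAt (discExtend (S.chart hA q₀ q : DiscMap n d))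
      (jetInclusion A b (S.jet q)) (closedBall 0 1) 1 := by
  rw [S.chart_apply hA q₀ hq]
  have hreg := S.isRegular _ hq.1
  refine (liftMap_hasDerivWithinAt_one hreg.norm_lt).congr_deriv ?_
  refine Prod.ext (Prod.ext rfl (funext fun j => ?_)) (Prod.ext ?_ (funext fun j => ?_))
  · have hK : (S.K q.1 j).IsHermitian :=
      isSelfAdjoint_of_stein hreg.norm_lt ((S.stein_eq _ hq.1 j).symm ▸ hA j)
    have hreal := star_dotProduct_mulVec ((1 - S.X q.1) *ᵥ q.2) ((1 - S.X q.1) *ᵥ q.2) (S.K q.1 j)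
    rw [hK.eq] at hreal
    simp only [jetInclusion, jet]
    rw [Complex.ofReal_mul, Complex.conj_eq_iff_re.1 hreal]
    simp
  · simp only [jetInclusion, jet]
    rw [hreg.pencil_eq hA, Matrix.star_mulVec, Matrix.vecMul_vecMul, star_neg, Matrix.neg_vecMul,
      mul_assoc]
  · simp only [jetInclusion, jet]
    apply Complex.ext <;> simp

end SolutionFamily

end Chart

/-! ### Existence of solution families -/

section Linearization

open scoped Matrix.Norms.L2Operator ContDiff Topology

variable {n d : ℕ} {A : Fin d → Matrix (Fin n) (Fin n) ℂ} {b : Fin d → ℝ}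

theorem contDiff_conjTranspose : ContDiff ℝ ω fun X : Matrix (Fin n) (Fin n) ℂ => Xᴴ :=
  (starL' ℝ : Matrix (Fin n) (Fin n) ℂ ≃L[ℝ] Matrix (Fin n) (Fin n) ℂ).contDiff

theorem hasDerivAt_coeffP {c : ℝ → Fin d → ℂ} {α : Fin d → ℂ} {t : ℝ} (hc : HasDerivAt c α t) :
    HasDerivAt (fun t => coeffP A (c t)) (coeffP A α) t := by
  unfold coeffP
  exact HasDerivAt.fun_sum fun j _ => (hasDerivAt_pi.1 hc j).smul_const (A j)

theorem hasDerivAt_coeffA {c : ℝ → Fin d → ℂ} {α : Fin d → ℂ} {t : ℝ} (hc : HasDerivAt c α t) :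
    HasDerivAt (fun t => coeffA A b (c t)) (coeffA A 0 α) t := by
  unfold coeffA
  refine HasDerivAt.fun_sum fun j _ => ?_
  have hj := hasDerivAt_pi.1 hc j
  simpa using ((hj.const_sub (b j : ℂ)).sub hj.star).smul_const (A j)

theorem hasDerivAt_add_smul {E : Type*} [NormedAddCommGroup E] [NormedSpace ℝ E] (x v : E) :
    HasDerivAt (fun t : ℝ => x + t • v) v 0 := by
  simpa using ((hasDerivAt_id (0 : ℝ)).smul_const v).const_add x

/-- The matrix equation for `X` together with the Stein equations for the `K_j`, as the zero set
of a function of `(a, (X, K))`. -/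
def system (A : Fin d → Matrix (Fin n) (Fin n) ℂ) (b : Fin d → ℝ)
    (u : (Fin d → ℂ) × (Matrix (Fin n) (Fin n) ℂ × (Fin d → Matrix (Fin n) (Fin n) ℂ))) :
    Matrix (Fin n) (Fin n) ℂ × (Fin d → Matrix (Fin n) (Fin n) ℂ) :=
  (coeffP A u.1 * u.2.1 ^ 2 + coeffA A b u.1 * u.2.1 + (coeffP A u.1)ᴴ,
   fun j => stein u.2.1 (u.2.2 j) - A j)

theorem system_eq_zero_iff {a : Fin d → ℂ} {X : Matrix (Fin n) (Fin n) ℂ}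
    {K : Fin d → Matrix (Fin n) (Fin n) ℂ} : system A b (a, (X, K)) = 0 ↔
      coeffP A a * X ^ 2 + coeffA A b a * X + (coeffP A a)ᴴ = 0 ∧ ∀ j, stein X (K j) = A j := by
  simp only [system, Prod.mk_eq_zero, funext_iff, Pi.zero_apply, sub_eq_zero]

theorem contDiff_system : ContDiff ℝ ω (system A b) := by
  let E := (Fin d → ℂ) × (Matrix (Fin n) (Fin n) ℂ × (Fin d → Matrix (Fin n) (Fin n) ℂ))
  have hP : ContDiff ℝ ω fun u : E => coeffP A u.1 := contDiff_coeffP.comp contDiff_fst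
  have hS : ContDiff ℝ ω fun u : E => coeffA A b u.1 := contDiff_coeffA.comp contDiff_fst
  have hP' : ContDiff ℝ ω fun u : E => (coeffP A u.1)ᴴ := contDiff_conjTranspose.comp hP
  have hX' : ContDiff ℝ ω fun u : E => star u.2.1 :=
    contDiff_conjTranspose.comp (contDiff_fst.comp contDiff_snd)
  unfold system
  simp only [stein_apply]
  fun_prop

theorem fderiv_system_apply (a α : Fin d → ℂ) (X Y : Matrix (Fin n) (Fin n) ℂ)
    (K L : Fin d → Matrix (Fin n) (Fin n) ℂ) :
    fderiv ℝ (system A b) (a, (X, K)) (α, (Y, L)) =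
      (coeffP A α * X ^ 2 + coeffP A a * (Y * X + X * Y) +
        (coeffA A 0 α * X + coeffA A b a * Y) + (coeffP A α)ᴴ,
       fun j => stein X (L j) - (Yᴴ * K j * X + Xᴴ * K j * Y)) := by
  have hsys : DifferentiableAt ℝ (system A b) (a, (X, K)) :=
    contDiff_system.contDiffAt.differentiableAt (by simp)
  refine (hsys.hasFDerivAt.hasLineDerivAt (α, (Y, L))).unique ?_
  change HasDerivAt (fun t : ℝ => system A b (a + t • α, (X + t • Y, K + t • L))) _ 0
  have hP := hasDerivAt_coeffP (A := A) (hasDerivAt_add_smul a α)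
  have hS := hasDerivAt_coeffA (A := A) (b := b) (hasDerivAt_add_smul a α)
  have hX := hasDerivAt_add_smul X Y
  refine HasDerivAt.prodMk ?_ (hasDerivAt_pi.2 fun j => ?_)
  · simp only [pow_two]
    refine (((hP.mul (hX.mul hX)).add (hS.mul hX)).add hP.star).congr_deriv ?_
    simp only [Pi.mul_apply, zero_smul, add_zero, Matrix.star_eq_conjTranspose]
  · have hK := hasDerivAt_pi.1 (hasDerivAt_add_smul K L) j
    refine ((hK.sub ((hX.star.mul hK).mul hX)).sub_const (A j)).congr_deriv ?_
    simp only [Pi.mul_apply, zero_smul, add_zero, Matrix.star_eq_conjTranspose, stein_apply,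
      Pi.add_apply, Pi.zero_apply]
    noncomm_ring

theorem stein_middleFactor_mul (hA : ∀ j, (A j).IsHermitian) {a : Fin d → ℂ}
    {X : Matrix (Fin n) (Fin n) ℂ} (h : IsRegularSolution A b a X)
    (Y : Matrix (Fin n) (Fin n) ℂ) : stein X (middleFactor A b a X * Y) =
      coeffP A a * (Y * X + X * Y) + coeffA A b a * Y := by
  have hP : coeffP A a = -(star X * middleFactor A b a X) :=
    coeff_eq_neg_star_mul (coeffA_isHermitian hA b a) h.eq h.norm_lt
  rw [stein_apply, ← mul_assoc, ← neg_neg (star X * middleFactor A b a X), ← hP, middleFactor]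
  noncomm_ring

theorem fderiv_system_comp_inr_injective (hA : ∀ j, (A j).IsHermitian) {a : Fin d → ℂ}
    {X : Matrix (Fin n) (Fin n) ℂ} (h : IsRegularSolution A b a X)
    (K : Fin d → Matrix (Fin n) (Fin n) ℂ) :
    Function.Injective (fderiv ℝ (system A b) (a, (X, K)) ∘L .inr ℝ (Fin d → ℂ)
      (Matrix (Fin n) (Fin n) ℂ × (Fin d → Matrix (Fin n) (Fin n) ℂ))) := by
  rw [injective_iff_map_eq_zero]
  rintro ⟨Y, L⟩ h0
  rw [ContinuousLinearMap.comp_apply, ContinuousLinearMap.inr_apply, fderiv_system_apply,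
    Prod.mk_eq_zero, funext_iff] at h0
  have hY : Y = 0 := by
    refine h.isUnit.mul_right_eq_zero.1 ((map_eq_zero_iff _ (stein_injective h.norm_lt)).1 ?_)
    rw [stein_middleFactor_mul hA h]
    simpa [coeffP, coeffA] using h0.1
  have hL : L = 0 := funext fun j =>
    (map_eq_zero_iff _ (stein_injective h.norm_lt)).1 (by simpa [hY] using h0.2 j)
  rw [hY, hL, Prod.mk_zero_zero]

theorem fderiv_system_comp_inr_isInvertible (hA : ∀ j, (A j).IsHermitian) {a : Fin d → ℂ}
    {X : Matrix (Fin n) (Fin n) ℂ} (h : IsRegularSolution A b a X)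
    (K : Fin d → Matrix (Fin n) (Fin n) ℂ) :
    (fderiv ℝ (system A b) (a, (X, K)) ∘L .inr ℝ (Fin d → ℂ)
      (Matrix (Fin n) (Fin n) ℂ × (Fin d → Matrix (Fin n) (Fin n) ℂ))).IsInvertible := by
  have hinj := fderiv_system_comp_inr_injective hA h K
  have hsurj := LinearMap.injective_iff_surjective.1 hinj
  exact ⟨ContinuousLinearEquiv.ofBijective _ (LinearMap.ker_eq_bot.2 hinj)
    (LinearMap.range_eq_top.2 hsurj), ContinuousLinearEquiv.coe_ofBijective ..⟩

theorem exists_solutionFamily (hA : ∀ j, (A j).IsHermitian) {a₀ : Fin d → ℂ}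
    {X₀ : Matrix (Fin n) (Fin n) ℂ} (h : IsRegularSolution A b a₀ X₀) :
    ∃ S : SolutionFamily A b, a₀ ∈ S.base ∧ S.X a₀ = X₀ := by
  choose K₀ hK₀ using fun j => stein_surjective h.norm_lt (A j)
  have hsys : ContDiffAt ℝ ω (system A b) (a₀, (X₀, K₀)) := contDiff_system.contDiffAt
  have hω : (ω : ℕ∞ω) ≠ 0 := by simp
  have hinv := fderiv_system_comp_inr_isInvertible hA h K₀
  let φ := hsys.implicitFunction hω hinv
  have hφ₀ : φ a₀ = (X₀, K₀) := hsys.implicitFunction_apply_self hω hinv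
  have hφ : ContDiffAt ℝ ω φ a₀ := hsys.contDiffAt_implicitFunction hω hinv
  have hφX : ContinuousAt (fun a => (φ a).1) a₀ := hφ.continuousAt.fst
  have hzero : ∀ᶠ a in 𝓝 a₀, system A b (a, φ a) = 0 :=
    system_eq_zero_iff.2 ⟨h.eq, hK₀⟩ ▸ hsys.eventually_apply_implicitFunction hω hinv
  have hnorm : ∀ᶠ a in 𝓝 a₀, ‖(φ a).1‖ < 1 :=
    hφX.norm.eventually_lt continuousAt_const (by simpa only [hφ₀] using h.norm_lt)
  have hunit : ∀ᶠ a in 𝓝 a₀, IsUnit (middleFactor A b a (φ a).1) := by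
    have hQ : ContinuousAt (fun a => middleFactor A b a (φ a).1) a₀ :=
      contDiff_coeffA.continuous.continuousAt.add
        (contDiff_coeffP.continuous.continuousAt.mul hφX)
    exact hQ.eventually (Units.isOpen.mem_nhds (by simpa only [hφ₀] using! h.isUnit))
  obtain ⟨O, hO, hOo, ha₀⟩ := _root_.eventually_nhds_iff.1
    ((hφ.eventually (by simp)).and (hzero.and (hnorm.and hunit)))
  have hφO : ContDiffOn ℝ ω φ O := fun a ha => (hO a ha).1.contDiffWithinAt
  exact ⟨{
    base := O
    isOpen_base := hOo
    X := fun a => (φ a).1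
    K := fun a => (φ a).2
    contDiffOn_X := hφO.fst
    contDiffOn_K := hφO.snd
    isRegular := fun a ha =>
      ⟨(system_eq_zero_iff.1 (hO a ha).2.1).1, (hO a ha).2.2.1, (hO a ha).2.2.2⟩
    stein_eq := fun a ha => (system_eq_zero_iff.1 (hO a ha).2.1).2 }, ha₀, congrArg Prod.fst hφ₀⟩

end Linearization

/-! ### The derivative of the `1`-jet map -/

section JetDerivative

open scoped Matrix.Norms.L2Operator ContDiff Topology Manifold

theorem isLocalDiffeomorphAt_of_injective_fderiv {E F : Type*} [NormedAddCommGroup E]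
    [NormedSpace ℝ E] [FiniteDimensional ℝ E] [NormedAddCommGroup F] [NormedSpace ℝ F]
    [FiniteDimensional ℝ F] (hEF : Module.finrank ℝ E = Module.finrank ℝ F) {f : E → F} {x : E}
    (hf : ContDiffAt ℝ ω f x) (hinj : Function.Injective (fderiv ℝ f x)) :
    IsLocalDiffeomorphAt 𝓘(ℝ, E) 𝓘(ℝ, F) ∞ f x := by
  have : CompleteSpace E := FiniteDimensional.complete ℝ E
  have hω : (ω : ℕ∞ω) ≠ 0 := by simp
  have hsurj : Function.Surjective (fderiv ℝ f x) :=
    (LinearMap.injective_iff_surjective_of_finrank_eq_finrank hEF).1 hinj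
  let f' : E ≃L[ℝ] F := ContinuousLinearEquiv.ofBijective (fderiv ℝ f x)
    (LinearMap.ker_eq_bot.2 hinj) (LinearMap.range_eq_top.2 hsurj)
  have hf' : HasFDerivAt f (f' : E →L[ℝ] F) x :=
    (hf.differentiableAt hω).hasFDerivAt.congr_fderiv
      (ContinuousLinearEquiv.coe_ofBijective ..).symm
  let e := hf.toOpenPartialHomeomorph f hf' hω
  have hsymm : ContDiffAt ℝ ω e.symm (f x) := hf.to_localInverse hf' hω
  obtain ⟨O, hO, hOo, hxO⟩ := _root_.eventually_nhds_iff.1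
    ((hf.eventually (by simp)).and (hf.continuousAt.eventually (hsymm.eventually (by simp))))
  let e' := e.restrOpen O hOo
  refine ⟨⟨e'.toPartialEquiv, e'.open_source, e'.open_target, ?_, ?_⟩,
    ⟨hf.mem_toOpenPartialHomeomorph_source hf' hω, hxO⟩, fun y _ => rfl⟩
  · exact ContDiffOn.contMDiffOn fun y hy => ((hO y hy.2).1.of_le le_top).contDiffWithinAt
  · refine ContDiffOn.contMDiffOn fun y hy => ?_
    have hy' : ContDiffAt ℝ ω e.symm (e' (e'.symm y)) := (hO _ (e'.map_target hy).2).2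
    rw [e'.right_inv hy] at hy'
    exact (hy'.of_le le_top).contDiffWithinAt

variable {n d : ℕ} {A : Fin d → Matrix (Fin n) (Fin n) ℂ} {b : Fin d → ℝ}

theorem star_mulVec_dotProduct_mulVec (M N : Matrix (Fin n) (Fin n) ℂ) (v : Fin n → ℂ) :
    star (M *ᵥ v) ⬝ᵥ N *ᵥ (M *ᵥ v) = star v ⬝ᵥ (Mᴴ * N * M) *ᵥ v := by
  rw [Matrix.star_mulVec, ← Matrix.dotProduct_mulVec, Matrix.mulVec_mulVec, Matrix.mulVec_mulVec,
    mul_assoc]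

theorem re_star_dotProduct_sum_smul_mulVec {ι : Type*} [Fintype ι]
    (M : Fin d → ι → Matrix (Fin n) (Fin n) ℂ) (v : Fin n → ℂ) (c : ι → ℝ) (j : Fin d) :
    (star v ⬝ᵥ (∑ s, (c s : ℂ) • M j s) *ᵥ v).re =
      (Matrix.of (fun j s => (star v ⬝ᵥ M j s *ᵥ v).re) *ᵥ c) j := by
  simp only [Matrix.sum_mulVec, dotProduct_sum, Complex.re_sum, Matrix.smul_mulVec,
    dotProduct_smul, smul_eq_mul, Complex.re_ofReal_mul, mul_comm (c _)]
  rfl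

theorem contDiff_hermitianForm :
    ContDiff ℝ ω fun p : (Fin n → ℂ) × (Fin n → ℂ) => (star p.1 ⬝ᵥ p.2).re := by
  have hstar : ∀ j, ContDiff ℝ ω fun p : (Fin n → ℂ) × (Fin n → ℂ) => star (p.1 j) := fun j =>
    (starL' ℝ : ℂ ≃L[ℝ] ℂ).contDiff.comp ((contDiff_apply ℝ ℂ j).comp contDiff_fst)
  have hsum : ContDiff ℝ ω fun p : (Fin n → ℂ) × (Fin n → ℂ) => ∑ j, star (p.1 j) * p.2 j := by
    fun_prop
  exact Complex.reCLM.contDiff.comp hsum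

theorem hasDerivAt_hermitianForm {M : ℝ → Matrix (Fin n) (Fin n) ℂ}
    {M' : Matrix (Fin n) (Fin n) ℂ} {t : ℝ} (hM : HasDerivAt M M' t) (v : Fin n → ℂ) :
    HasDerivAt (fun t => (star v ⬝ᵥ M t *ᵥ v).re) (star v ⬝ᵥ M' *ᵥ v).re t := by
  let φ : Matrix (Fin n) (Fin n) ℂ →ₗ[ℝ] ℝ :=
    { toFun := fun M => (star v ⬝ᵥ M *ᵥ v).re
      map_add' := fun M N => by simp [Matrix.add_mulVec]
      map_smul' := fun c M => by simp [Matrix.smul_mulVec] }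
  exact φ.toContinuousLinearMap.hasFDerivAt.comp_hasDerivAt t hM

section SteinIdentities

variable {R : Type*} [NormedRing R] [StarRing R] [NormedStarGroup R] [NormedAlgebra ℂ R]
  {X K G Y L : R}

/-- The derivative of `(1 - X⋆) K (1 - X)` when `X` and `K` move with derivatives `Y` and `L`
subject to the linearized equations. -/
theorem deriv_conj_one_sub_eq (hX : ‖X‖ < 1) (hK : IsSelfAdjoint K)
    (hY : K * Y = -(stein X G * (1 - X) ^ 2))
    (hL : stein X L = star Y * K * X + star X * K * Y) :
    star (1 - X) * L * (1 - X) - star Y * K * (1 - X) - star (1 - X) * K * Y =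
      star ((1 - X) ^ 2) * G * (1 - X) ^ 2 + star (star ((1 - X) ^ 2) * G * (1 - X) ^ 2) := by
  have hY' : star Y * K = -(star ((1 - X) ^ 2) * star (stein X G)) := by
    simpa [hK.star_eq] using congrArg star hY
  have hL' : L = -(star X * G * (1 - X) ^ 2) + star (-(star X * G * (1 - X) ^ 2)) := by
    refine stein_injective hX ?_
    rw [hL, map_add, stein_star, mul_assoc (star X), hY, hY']
    simp only [stein_apply, star_neg, star_mul, star_sub, star_one, star_star, star_pow]
    noncomm_ring
  rw [hL', mul_assoc _ K Y, hY, hY']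
  simp only [stein_apply, star_neg, star_mul, star_sub, star_one, star_star, star_pow]
  noncomm_ring

end SteinIdentities

namespace SolutionFamily

variable (S : SolutionFamily A b) {a₀ α : Fin d → ℂ}

theorem contDiffAt_X (ha₀ : a₀ ∈ S.base) : ContDiffAt ℝ ω S.X a₀ :=
  S.contDiffOn_X.contDiffAt (S.isOpen_base.mem_nhds ha₀)

theorem contDiffAt_K (ha₀ : a₀ ∈ S.base) : ContDiffAt ℝ ω S.K a₀ :=
  S.contDiffOn_K.contDiffAt (S.isOpen_base.mem_nhds ha₀)

theorem contDiffAt_jet (ha₀ : a₀ ∈ S.base) (V₀ : Fin n → ℂ) :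
    ContDiffAt ℝ ω S.jet (a₀, V₀) := by
  have hmulVec : ContDiff ℝ ω fun p : Matrix (Fin n) (Fin n) ℂ × (Fin n → ℂ) => p.1 *ᵥ p.2 :=
    contDiff_mulVec.restrict_scalars ℝ
  have hX : ContDiffAt ℝ ω (fun q : (Fin d → ℂ) × (Fin n → ℂ) => S.X q.1) (a₀, V₀) :=
    (S.contDiffAt_X ha₀).comp (a₀, V₀) contDiffAt_fst
  have hK : ContDiffAt ℝ ω (fun q : (Fin d → ℂ) × (Fin n → ℂ) => S.K q.1) (a₀, V₀) :=
    (S.contDiffAt_K ha₀).comp (a₀, V₀) contDiffAt_fst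
  have hW : ContDiffAt ℝ ω (fun q : (Fin d → ℂ) × (Fin n → ℂ) => (1 - S.X q.1) *ᵥ q.2)
      (a₀, V₀) :=
    hmulVec.contDiffAt.comp (a₀, V₀) ((contDiffAt_const.sub hX).prodMk contDiffAt_snd)
  refine contDiffAt_snd.neg.prodMk
    ((contDiffAt_pi.2 fun j => ?_).prodMk (contDiffAt_pi.2 fun j => ?_))
  · have hKW : ContDiffAt ℝ ω (fun q : (Fin d → ℂ) × (Fin n → ℂ) =>
        S.K q.1 j *ᵥ ((1 - S.X q.1) *ᵥ q.2)) (a₀, V₀) :=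
      hmulVec.contDiffAt.comp (a₀, V₀) ((contDiffAt_pi.1 hK j).prodMk hW)
    exact contDiffAt_const.mul (contDiff_hermitianForm.contDiffAt.comp (a₀, V₀) (hW.prodMk hKW))
  · have him : ContDiff ℝ ω fun q : (Fin d → ℂ) × (Fin n → ℂ) => (q.1 j).im :=
      Complex.imCLM.contDiff.comp ((contDiff_apply ℝ ℂ j).comp contDiff_fst)
    exact him.neg.contDiffAt

theorem fderiv_system_eq_zero (ha₀ : a₀ ∈ S.base) :
    fderiv ℝ (system A b) (a₀, (S.X a₀, S.K a₀))
      (α, (fderiv ℝ S.X a₀ α, fderiv ℝ S.K a₀ α)) = 0 := by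
  have hX := ((S.contDiffAt_X ha₀).differentiableAt (by simp)).hasFDerivAt
  have hK := ((S.contDiffAt_K ha₀).differentiableAt (by simp)).hasFDerivAt
  have hsys : HasFDerivAt (system A b) _ (a₀, (S.X a₀, S.K a₀)) :=
    (contDiff_system.contDiffAt.differentiableAt (by simp)).hasFDerivAt
  have hcomp := hsys.comp a₀ ((hasFDerivAt_id a₀).prodMk (hX.prodMk hK))
  have hzero : system A b ∘ (fun a => (a, (S.X a, S.K a))) =ᶠ[𝓝 a₀] fun _ => 0 := by
    filter_upwards [S.isOpen_base.mem_nhds ha₀] with a ha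
    exact system_eq_zero_iff.2 ⟨(S.isRegular a ha).eq, S.stein_eq a ha⟩
  exact DFunLike.congr_fun
    (hcomp.unique ((hasFDerivAt_const 0 a₀).congr_of_eventuallyEq hzero)) α

theorem stein_fderiv_X (hA : ∀ j, (A j).IsHermitian) (ha₀ : a₀ ∈ S.base)
    (hα : ∀ j, star (α j) = α j) :
    stein (S.X a₀) (middleFactor A b a₀ (S.X a₀) * fderiv ℝ S.X a₀ α) =
      -(coeffP A α * (1 - S.X a₀) ^ 2) := by
  have hlin := S.fderiv_system_eq_zero (α := α) ha₀
  rw [fderiv_system_apply, Prod.mk_eq_zero] at hlin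
  have hP : (coeffP A α)ᴴ = coeffP A α :=
    (coeffP_conjTranspose hA α).trans (by simp only [hα, coeffP])
  have hS : coeffA A 0 α = -(2 • coeffP A α) := by
    simp only [coeffA, coeffP, hα, Finset.smul_sum, ← Finset.sum_neg_distrib]
    refine Finset.sum_congr rfl fun j _ => ?_
    simp only [Pi.zero_apply, Complex.ofReal_zero]
    module
  rw [stein_middleFactor_mul hA (S.isRegular a₀ ha₀), eq_neg_iff_add_eq_zero, ← hlin.1, hP, hS]
  noncomm_ring

theorem stein_fderiv_K (ha₀ : a₀ ∈ S.base) (j : Fin d) :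
    stein (S.X a₀) (fderiv ℝ S.K a₀ α j) =
      (fderiv ℝ S.X a₀ α)ᴴ * S.K a₀ j * S.X a₀ + (S.X a₀)ᴴ * S.K a₀ j * fderiv ℝ S.X a₀ α := by
  have hlin := S.fderiv_system_eq_zero (α := α) ha₀
  rw [fderiv_system_apply, Prod.mk_eq_zero, funext_iff] at hlin
  exact sub_eq_zero.1 (hlin.2 j)

theorem fderiv_X (hA : ∀ j, (A j).IsHermitian) (ha₀ : a₀ ∈ S.base)
    (hα : ∀ j, star (α j) = α j) :
    fderiv ℝ S.X a₀ α = -((middleFactor A b a₀ (S.X a₀))⁻¹ * (∑ s, α s • S.K a₀ s) *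
      (1 - S.X a₀) ^ 2) := by
  have h := S.isRegular a₀ ha₀
  have hN : stein (S.X a₀) (∑ s, α s • S.K a₀ s) = coeffP A α := by
    simp only [map_sum, map_smul, S.stein_eq a₀ ha₀, coeffP]
  have hQY : middleFactor A b a₀ (S.X a₀) * fderiv ℝ S.X a₀ α =
      -((∑ s, α s • S.K a₀ s) * (1 - S.X a₀) ^ 2) := by
    refine stein_injective h.norm_lt ?_
    rw [S.stein_fderiv_X hA ha₀ hα, ← hN, stein_apply, stein_apply]
    noncomm_ring
  rw [← Matrix.nonsing_inv_mul_cancel_left _ (fderiv ℝ S.X a₀ α)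
    ((Matrix.isUnit_iff_isUnit_det _).1 h.isUnit), hQY]
  noncomm_ring

theorem hasDerivAt_jet (ha₀ : a₀ ∈ S.base) (V₀ W : Fin n → ℂ) :
    HasDerivAt (fun t : ℝ => S.jet (a₀ + t • α, V₀ + t • W))
      (fderiv ℝ S.jet (a₀, V₀) (α, W)) 0 :=
  ((S.contDiffAt_jet ha₀ V₀).differentiableAt (by simp)).hasFDerivAt.hasLineDerivAt (α, W)

theorem fderiv_jet_fst (ha₀ : a₀ ∈ S.base) (V₀ W : Fin n → ℂ) :
    (fderiv ℝ S.jet (a₀, V₀) (α, W)).1 = -W :=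
  HasDerivAt.unique ((ContinuousLinearMap.fst ℝ (Fin n → ℂ) _).hasFDerivAt.comp_hasDerivAt
    (0 : ℝ) (S.hasDerivAt_jet ha₀ V₀ W)) (hasDerivAt_add_smul V₀ W).neg

theorem fderiv_jet_snd_snd (ha₀ : a₀ ∈ S.base) (V₀ W : Fin n → ℂ) (j : Fin d) :
    (fderiv ℝ S.jet (a₀, V₀) (α, W)).2.2 j = -(α j).im :=
  (hasDerivAt_pi.1 ((hasFDerivAt_snd.comp _ hasFDerivAt_snd).comp_hasDerivAt (0 : ℝ)
      (S.hasDerivAt_jet ha₀ V₀ W)) j).unique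
    (Complex.imCLM.hasFDerivAt.comp_hasDerivAt (0 : ℝ)
      (hasDerivAt_pi.1 (hasDerivAt_add_smul a₀ α) j)).neg

theorem fderiv_jet_snd_fst (ha₀ : a₀ ∈ S.base) (V₀ : Fin n → ℂ) (j : Fin d) :
    (fderiv ℝ S.jet (a₀, V₀) (α, 0)).2.1 j =
      -2 * (star V₀ ⬝ᵥ ((1 - S.X a₀)ᴴ * fderiv ℝ S.K a₀ α j * (1 - S.X a₀) -
        (fderiv ℝ S.X a₀ α)ᴴ * S.K a₀ j * (1 - S.X a₀) -
        (1 - S.X a₀)ᴴ * S.K a₀ j * fderiv ℝ S.X a₀ α) *ᵥ V₀).re := by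
  refine (hasDerivAt_pi.1 ((hasFDerivAt_fst.comp _ hasFDerivAt_snd).comp_hasDerivAt (0 : ℝ)
    (S.hasDerivAt_jet ha₀ V₀ 0)) j).unique ?_
  have hX : HasDerivAt (fun t : ℝ => 1 - S.X (a₀ + t • α)) (-fderiv ℝ S.X a₀ α) 0 :=
    (((S.contDiffAt_X ha₀).differentiableAt (by simp)).hasFDerivAt.hasLineDerivAt α).const_sub 1
  have hK : HasDerivAt (fun t : ℝ => S.K (a₀ + t • α)) (fderiv ℝ S.K a₀ α) 0 :=
    ((S.contDiffAt_K ha₀).differentiableAt (by simp)).hasFDerivAt.hasLineDerivAt α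
  have hM := (hX.star.mul (hasDerivAt_pi.1 hK j)).mul hX
  refine (((hasDerivAt_hermitianForm hM V₀).const_mul (-2)).congr_deriv ?_).congr_of_eventuallyEq
    (Filter.Eventually.of_forall fun t => ?_)
  · congr 5
    simp only [Pi.mul_apply, zero_smul, add_zero, star_neg, Matrix.star_eq_conjTranspose]
    noncomm_ring
  · simp only [Function.comp_apply, jet, star_mulVec_dotProduct_mulVec,
      ← Matrix.star_eq_conjTranspose, smul_zero, add_zero]
    rfl

theorem fderiv_jet_real (hA : ∀ j, (A j).IsHermitian) (ha₀ : a₀ ∈ S.base) (V₀ : Fin n → ℂ)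
    {G : Fin d → Fin d → Matrix (Fin n) (Fin n) ℂ} (hG : ∀ j s, stein (S.X a₀) (G j s) =
      S.K a₀ j * (middleFactor A b a₀ (S.X a₀))⁻¹ * S.K a₀ s) (β : Fin d → ℝ) :
    (fderiv ℝ S.jet (a₀, V₀) (fun j => (β j : ℂ), 0)).2.1 =
      (-4 : ℝ) • (Matrix.of fun j s => (star ((1 - S.X a₀) ^ 2 *ᵥ V₀) ⬝ᵥ
        G j s *ᵥ ((1 - S.X a₀) ^ 2 *ᵥ V₀)).re) *ᵥ β := by
  have h := S.isRegular a₀ ha₀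
  ext j
  have hK : IsSelfAdjoint (S.K a₀ j) :=
    isSelfAdjoint_of_stein h.norm_lt (S.stein_eq a₀ ha₀ j ▸ hA j)
  have hKY : S.K a₀ j * fderiv ℝ S.X a₀ (fun j => (β j : ℂ)) =
      -(stein (S.X a₀) (∑ s, (β s : ℂ) • G j s) * (1 - S.X a₀) ^ 2) := by
    rw [S.fderiv_X hA ha₀ fun s => Complex.conj_ofReal _]
    simp only [map_sum, map_smul, hG, Finset.mul_sum, Finset.sum_mul, mul_neg, mul_smul_comm,
      smul_mul_assoc, mul_assoc]
  have hderiv := deriv_conj_one_sub_eq h.norm_lt hK hKY (S.stein_fderiv_K ha₀ j)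
  simp only [Matrix.star_eq_conjTranspose] at hderiv
  rw [S.fderiv_jet_snd_fst ha₀, hderiv, Matrix.add_mulVec, dotProduct_add,
    ← star_dotProduct_mulVec, ← star_mulVec_dotProduct_mulVec, Complex.add_re, Complex.star_def,
    Complex.conj_re, re_star_dotProduct_sum_smul_mulVec, Pi.smul_apply, smul_eq_mul]
  ring

end SolutionFamily

theorem oneJetIsLocalDiffeoAt_of_isUnit (hA : ∀ j, (A j).IsHermitian) {a₀ : Fin d → ℂ}
    {X : Matrix (Fin n) (Fin n) ℂ} (h : IsRegularSolution A b a₀ X)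
    {K : Fin d → Matrix (Fin n) (Fin n) ℂ} (hK : ∀ j, stein X (K j) = A j)
    {G : Fin d → Fin d → Matrix (Fin n) (Fin n) ℂ}
    (hG : ∀ j s, stein X (G j s) = K j * (middleFactor A b a₀ X)⁻¹ * K s)
    {V₀ : Fin n → ℂ} (hV₀ : V₀ ≠ 0)
    (hunit : IsUnit (Matrix.of fun j s => (star ((1 - X) ^ 2 *ᵥ V₀) ⬝ᵥ
      G j s *ᵥ ((1 - X) ^ 2 *ᵥ V₀)).re)) :
    OneJetIsLocalDiffeoAt A b (a₀, V₀) := by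
  obtain ⟨S, ha₀, rfl⟩ := exists_solutionFamily hA h
  obtain rfl : S.K a₀ = K :=
    funext fun j => stein_injective h.norm_lt ((S.stein_eq a₀ ha₀ j).trans (hK j).symm)
  refine ⟨S.chart hA ⟨(a₀, V₀), ha₀, hV₀⟩, ⟨ha₀, hV₀⟩, fun q hq => S.hasParameters_chart hA _ hq,
    S.jet, fun q hq => S.hasDerivWithinAt_chart hA _ hq, ?_⟩
  refine isLocalDiffeomorphAt_of_injective_fderiv ?_ (S.contDiffAt_jet ha₀ V₀)
    ((injective_iff_map_eq_zero _).2 ?_)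
  · simp only [Module.finrank_prod, Module.finrank_pi_fintype, Complex.finrank_real_complex,
      Module.finrank_self, Finset.sum_const, Finset.card_univ, Fintype.card_fin, smul_eq_mul]
    ring
  rintro ⟨α, W⟩ h0
  have hW : W = 0 := neg_eq_zero.1 ((S.fderiv_jet_fst ha₀ V₀ W).symm.trans (congrArg Prod.fst h0))
  have him : ∀ j, (α j).im = 0 := fun j => neg_eq_zero.1
    ((S.fderiv_jet_snd_snd ha₀ V₀ W j).symm.trans (congrFun (congrArg (·.2.2) h0) j))
  obtain ⟨β, rfl⟩ : ∃ β : Fin d → ℝ, α = fun j => (β j : ℂ) :=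
    ⟨fun j => (α j).re, funext fun j => Complex.ext rfl (him j)⟩
  subst hW
  have hβ := (S.fderiv_jet_real hA ha₀ V₀ hG β).symm.trans (congrArg (·.2.1) h0)
  have hβ0 : β = 0 := (Matrix.mulVec_injective_iff_isUnit.2 hunit) (by simpa using hβ)
  simp [hβ0, Prod.ext_iff, funext_iff]

end JetDerivative

/-! ### Diagonal solutions -/

section DiagonalSolution

open scoped Matrix.Norms.L2Operator Topology

variable {n d : ℕ}

/-- The Cauchy kernel `(1 - x_k x_l)⁻¹`, entrywise multiplication by which inverts the Stein
operator of the diagonal matrix of `x`. -/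
def cauchyKernel (x : Fin n → ℝ) : Matrix (Fin n) (Fin n) ℝ :=
  Matrix.of fun k l => (1 - x k * x l)⁻¹

theorem cauchyKernel_apply (x : Fin n → ℝ) (k l : Fin n) :
    cauchyKernel x k l = (1 - x k * x l)⁻¹ := rfl

theorem cauchyKernel_comm (x : Fin n → ℝ) (k l : Fin n) :
    cauchyKernel x k l = cauchyKernel x l k := by
  rw [cauchyKernel_apply, cauchyKernel_apply, mul_comm]

theorem cauchyKernel_zero : cauchyKernel (0 : Fin n → ℝ) = Matrix.of 1 := by
  ext k l
  simp [cauchyKernel_apply]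

theorem abs_mul_lt_one {x : Fin n → ℝ} (hx : ∀ k, |x k| < 1) (k l : Fin n) :
    |x k * x l| < 1 := by
  rw [abs_mul]
  exact mul_lt_one_of_nonneg_of_lt_one_left (abs_nonneg _) (hx k) (hx l).le

theorem one_sub_mul_ne_zero {x : Fin n → ℝ} (hx : ∀ k, |x k| < 1) (k l : Fin n) :
    1 - x k * x l ≠ 0 :=
  (sub_pos.2 (abs_lt.1 (abs_mul_lt_one hx k l)).2).ne'

theorem stein_diagonal_hadamard_cauchyKernel {x : Fin n → ℝ} (hx : ∀ k, |x k| < 1)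
    (Z : Matrix (Fin n) (Fin n) ℂ) :
    stein (Matrix.diagonal fun k => (x k : ℂ)) (Z ⊙ (cauchyKernel x).map Complex.ofReal) = Z := by
  ext k l
  have hne : (1 - x k * x l : ℂ) ≠ 0 := by exact_mod_cast one_sub_mul_ne_zero hx k l
  simp only [stein_apply, Matrix.star_eq_conjTranspose, Matrix.diagonal_conjTranspose,
    Matrix.sub_apply, Matrix.mul_diagonal, Matrix.diagonal_mul, Matrix.hadamard_apply,
    Matrix.map_apply, cauchyKernel_apply, Pi.star_apply, Complex.star_def, Complex.conj_ofReal,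
    Complex.ofReal_inv, Complex.ofReal_sub, Complex.ofReal_mul, Complex.ofReal_one]
  field_simp

theorem star_ofReal_dotProduct_mulVec (N : Matrix (Fin n) (Fin n) ℂ) (u : Fin n → ℝ) :
    star (fun k => (u k : ℂ)) ⬝ᵥ N *ᵥ (fun k => (u k : ℂ)) =
      ∑ k, ∑ l, ((u k * u l : ℝ) : ℂ) * N k l := by
  simp only [dotProduct, Matrix.mulVec, Finset.mul_sum, Pi.star_apply, Complex.star_def,
    Complex.conj_ofReal, Complex.ofReal_mul]
  exact Finset.sum_congr rfl fun k _ => Finset.sum_congr rfl fun l _ => by ring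

theorem hasSum_star_diagonal_pow_mulVec {x : Fin n → ℝ} (hx : ∀ k, |x k| < 1) (V : Fin n → ℝ)
    (N : Matrix (Fin n) (Fin n) ℂ) :
    HasSum (fun r : ℕ => star ((Matrix.diagonal fun k => (x k : ℂ)) ^ r *ᵥ fun k => (V k : ℂ)) ⬝ᵥ
        N *ᵥ ((Matrix.diagonal fun k => (x k : ℂ)) ^ r *ᵥ fun k => (V k : ℂ)))
      (∑ k, ∑ l, ((Matrix.vecMulVec V V ⊙ cauchyKernel x) k l : ℂ) * N k l) := by
  have hpow : ∀ r : ℕ, (Matrix.diagonal fun k => (x k : ℂ)) ^ r *ᵥ (fun k => (V k : ℂ)) =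
      fun k => ((x k ^ r * V k : ℝ) : ℂ) := fun r => by
    ext k
    rw [Matrix.diagonal_pow, Matrix.mulVec_diagonal]
    push_cast
    rfl
  simp only [hpow, star_ofReal_dotProduct_mulVec]
  refine hasSum_sum fun k _ => hasSum_sum fun l _ => HasSum.mul_right _ ?_
  have hgeom := (hasSum_geometric_of_abs_lt_one (abs_mul_lt_one hx k l)).mul_left (V k * V l)
  refine Complex.hasSum_ofReal.2 (hgeom.congr_fun fun r => ?_)
  ring

/-- The weighted real Gram matrix `Re ∑_{k,l} W_{kl} (K_j diag(δ) K_s)_{kl}`, where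
`K_j = A_j ⊙ κ`. Both nondegeneracy conditions reduce to it when `X` is a real diagonal matrix. -/
def weightedGram (A : Fin d → Matrix (Fin n) (Fin n) ℂ) (W κ : Matrix (Fin n) (Fin n) ℝ)
    (δ : Fin n → ℝ) : Matrix (Fin d) (Fin d) ℝ :=
  Matrix.of fun j s => (∑ k, ∑ l, (W k l : ℂ) * ((A j ⊙ κ.map Complex.ofReal) *
    (Matrix.diagonal fun k => (δ k : ℂ)) * (A s ⊙ κ.map Complex.ofReal)) k l).re

theorem weightedGram_vecMulVec_hadamard_apply (A : Fin d → Matrix (Fin n) (Fin n) ℂ)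
    (C κ : Matrix (Fin n) (Fin n) ℝ) (δ u : Fin n → ℝ) (j s : Fin d) :
    weightedGram A (Matrix.vecMulVec u u ⊙ C) κ δ j s =
      (star (fun k => (u k : ℂ)) ⬝ᵥ (((A j ⊙ κ.map Complex.ofReal) *
        (Matrix.diagonal fun k => (δ k : ℂ)) * (A s ⊙ κ.map Complex.ofReal)) ⊙
          C.map Complex.ofReal) *ᵥ fun k => (u k : ℂ)).re := by
  rw [weightedGram, Matrix.of_apply, star_ofReal_dotProduct_mulVec]
  simp only [Matrix.hadamard_apply, Matrix.vecMulVec_apply, Matrix.map_apply, Complex.ofReal_mul,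
    mul_assoc, mul_comm (C _ _ : ℂ)]

variable {A : Fin d → Matrix (Fin n) (Fin n) ℂ} {b : Fin d → ℝ} {a : Fin d → ℂ}
  {p σ x : Fin n → ℝ}

/-- The matrices `P = diag(p)` and `A = diag(σ)` are diagonal and `X = diag(x)` solves the
resulting scalar equations, with `‖X‖ < 1` and `A + P X` invertible. -/
structure IsDiagonalSolution (A : Fin d → Matrix (Fin n) (Fin n) ℂ) (b : Fin d → ℝ)
    (a : Fin d → ℂ) (p σ x : Fin n → ℝ) : Prop where
  coeffP_eq : coeffP A a = Matrix.diagonal fun k => (p k : ℂ)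
  coeffA_eq : coeffA A b a = Matrix.diagonal fun k => (σ k : ℂ)
  eq : ∀ k, p k * x k ^ 2 + σ k * x k + p k = 0
  abs_lt : ∀ k, |x k| < 1
  ne_zero : ∀ k, σ k + p k * x k ≠ 0

theorem inv_diagonal_ofReal {σ : Fin n → ℝ} (hσ : ∀ k, σ k ≠ 0) :
    (Matrix.diagonal fun k => (σ k : ℂ))⁻¹ = Matrix.diagonal fun k => (((σ k)⁻¹ : ℝ) : ℂ) := by
  refine Matrix.inv_eq_right_inv ?_
  rw [Matrix.diagonal_mul_diagonal, ← Matrix.diagonal_one]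
  congr 1
  ext k
  rw [← Complex.ofReal_mul, mul_inv_cancel₀ (hσ k), Complex.ofReal_one]

namespace IsDiagonalSolution

theorem middleFactor_eq (h : IsDiagonalSolution A b a p σ x) :
    middleFactor A b a (Matrix.diagonal fun k => (x k : ℂ)) =
      Matrix.diagonal fun k => ((σ k + p k * x k : ℝ) : ℂ) := by
  rw [middleFactor, h.coeffA_eq, h.coeffP_eq, Matrix.diagonal_mul_diagonal, Matrix.diagonal_add]
  push_cast
  rfl

theorem isRegularSolution (h : IsDiagonalSolution A b a p σ x) :
    IsRegularSolution A b a (Matrix.diagonal fun k => (x k : ℂ)) where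
  eq := by
    have heq : ∀ k, (p k * x k ^ 2 + σ k * x k + p k : ℂ) = 0 := fun k => by
      exact_mod_cast h.eq k
    rw [h.coeffA_eq, h.coeffP_eq, Matrix.diagonal_pow, Matrix.diagonal_mul_diagonal,
      Matrix.diagonal_mul_diagonal, Matrix.diagonal_add, Matrix.diagonal_conjTranspose,
      Matrix.diagonal_add, ← Matrix.diagonal_zero]
    congr 1
    ext k
    simpa using heq k
  norm_lt := by
    rw [Matrix.l2_opNorm_diagonal, pi_norm_lt_iff one_pos]
    exact fun k => (Complex.norm_real _).trans_lt (h.abs_lt k)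
  isUnit := by
    rw [h.middleFactor_eq, Matrix.isUnit_diagonal, Pi.isUnit_iff]
    exact fun k => isUnit_iff_ne_zero.2 (Complex.ofReal_ne_zero.2 (h.ne_zero k))

theorem daMatrix_eq (h : IsDiagonalSolution A b a p σ x) (hσ : ∀ k, σ k ≠ 0) (V : Fin n → ℝ) :
    DaMatrix A b a (Matrix.diagonal fun k => (x k : ℂ)) (fun k => (V k : ℂ)) =
      weightedGram A (Matrix.vecMulVec V V ⊙ cauchyKernel x) (cauchyKernel 0)
        fun k => (σ k)⁻¹ := by
  have hone : (Matrix.of (1 : Fin n → Fin n → ℝ)).map Complex.ofReal = Matrix.of 1 := by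
    ext _ _
    exact Complex.ofReal_one
  ext j s
  rw [DaMatrix, weightedGram, Matrix.of_apply, Matrix.of_apply,
    (hasSum_star_diagonal_pow_mulVec h.abs_lt V _).tsum_eq, h.coeffA_eq, inv_diagonal_ofReal hσ,
    cauchyKernel_zero, hone, Matrix.hadamard_of_one, Matrix.hadamard_of_one]

theorem isDaNondegenerateAt (h : IsDiagonalSolution A b a p σ x)
    (hA : ∀ j, (A j).IsHermitian) (hσ : ∀ k, σ k ≠ 0) {V : Fin n → ℝ}
    (hdet : (weightedGram A (Matrix.vecMulVec V V ⊙ cauchyKernel x) (cauchyKernel 0)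
      fun k => (σ k)⁻¹).det ≠ 0) :
    IsDaNondegenerateAt A b a fun k => (V k : ℂ) := by
  have hX := h.isRegularSolution
  have hone_sub : IsUnit (1 - Matrix.diagonal fun k => (x k : ℂ)) :=
    isUnit_one_sub_of_norm_lt_one hX.norm_lt
  refine ⟨?_, ?_, _, hX.isSmallSolution hA, ?_⟩
  · rw [hX.pencil_eq hA]
    exact (hone_sub.star.mul hX.isUnit).mul hone_sub
  · rw [h.coeffA_eq, Matrix.isUnit_diagonal, Pi.isUnit_iff]
    exact fun k => isUnit_iff_ne_zero.2 (Complex.ofReal_ne_zero.2 (hσ k))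
  · rw [h.daMatrix_eq hσ, Matrix.isUnit_iff_isUnit_det]
    exact hdet.isUnit

theorem oneJetIsLocalDiffeoAt (h : IsDiagonalSolution A b a p σ x)
    (hA : ∀ j, (A j).IsHermitian) {V : Fin n → ℝ} (hV : V ≠ 0)
    (hdet : (weightedGram A (Matrix.vecMulVec (fun k => (1 - x k) ^ 2 * V k)
      (fun k => (1 - x k) ^ 2 * V k) ⊙ cauchyKernel x) (cauchyKernel x)
      fun k => (σ k + p k * x k)⁻¹).det ≠ 0) :
    OneJetIsLocalDiffeoAt A b (a, fun k => (V k : ℂ)) := by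
  have hU : (1 - Matrix.diagonal fun k => (x k : ℂ)) ^ 2 *ᵥ (fun k => (V k : ℂ)) =
      fun k => (((1 - x k) ^ 2 * V k : ℝ) : ℂ) := by
    ext k
    rw [← Matrix.diagonal_one, Matrix.diagonal_sub, Matrix.diagonal_pow, Matrix.mulVec_diagonal]
    push_cast
    rfl
  refine oneJetIsLocalDiffeoAt_of_isUnit hA h.isRegularSolution
    (fun j => stein_diagonal_hadamard_cauchyKernel h.abs_lt (A j))
    (fun j s => stein_diagonal_hadamard_cauchyKernel h.abs_lt _)
    (fun h0 => hV (funext fun k => Complex.ofReal_eq_zero.1 (congrFun h0 k))) ?_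
  simp only [hU, h.middleFactor_eq, inv_diagonal_ofReal h.ne_zero,
    ← weightedGram_vecMulVec_hadamard_apply]
  exact (Matrix.isUnit_iff_isUnit_det _).2 hdet.isUnit

end IsDiagonalSolution

end DiagonalSolution

/-! ### Perturbation of a singular Gram matrix -/

section Perturbation

open scoped Topology

/-- If the rows of `N t` annihilate `M₀ t`, a kernel vector of `M₀ t + η t • M₁ t` with `η t ≠ 0`
is also one of `N t * M₁ t`, and having no common kernel vector is an open condition. -/
theorem eventually_det_add_smul_ne_zero {𝕜 T ι m : Type*} [NontriviallyNormedField 𝕜]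
    [CompleteSpace 𝕜] [Fintype ι] [DecidableEq ι] [Finite m] {l : Filter T}
    {M₀ M₁ : T → Matrix ι ι 𝕜} {N : T → Matrix m ι 𝕜} {η : T → 𝕜} {L₀ L₁ : Matrix ι ι 𝕜}
    {N' : Matrix m ι 𝕜} (hM₀ : Filter.Tendsto M₀ l (𝓝 L₀)) (hM₁ : Filter.Tendsto M₁ l (𝓝 L₁))
    (hN : Filter.Tendsto N l (𝓝 N')) (hη : Filter.Tendsto η l (𝓝 0))
    (hker : ∀ t, N t * M₀ t = 0)
    (hlim : ∀ v, L₀ *ᵥ v = 0 → (N' * L₁) *ᵥ v = 0 → v = 0) :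
    ∀ᶠ t in l, η t ≠ 0 → (M₀ t + η t • M₁ t).det ≠ 0 := by
  cases nonempty_fintype m
  have hB : Filter.Tendsto
      (fun t => (Matrix.fromRows (M₀ t + η t • M₁ t) (N t * M₁ t)).col) l
      (𝓝 (Matrix.fromRows L₀ (N' * L₁)).col) := by
    have hM : Filter.Tendsto (fun t => M₀ t + η t • M₁ t) l (𝓝 L₀) := by
      have hsum := hM₀.add (hη.smul hM₁)
      rwa [zero_smul, add_zero] at hsum
    have hNM : Filter.Tendsto (fun t => N t * M₁ t) l (𝓝 (N' * L₁)) := by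
      refine tendsto_pi_nhds.2 fun i => tendsto_pi_nhds.2 fun j => ?_
      simp only [Matrix.mul_apply]
      exact tendsto_finsetSum _ fun k _ =>
        ((hN.apply_nhds i).apply_nhds k).mul ((hM₁.apply_nhds k).apply_nhds j)
    exact tendsto_pi_nhds.2 fun j => tendsto_pi_nhds.2 <| Sum.rec
      (fun i => (hM.apply_nhds i).apply_nhds j) (fun i => (hNM.apply_nhds i).apply_nhds j)
  have hinj : Function.Injective (Matrix.fromRows L₀ (N' * L₁)).mulVec :=
    (injective_iff_map_eq_zero (Matrix.mulVecLin _)).2 fun v hv => by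
      rw [Matrix.mulVecLin_apply, Matrix.fromRows_mulVec] at hv
      exact hlim v (funext fun i => congrFun hv (Sum.inl i))
        (funext fun i => congrFun hv (Sum.inr i))
  have hindep : ∀ᶠ w in 𝓝 (Matrix.fromRows L₀ (N' * L₁)).col, LinearIndependent 𝕜 w :=
    (Matrix.mulVec_injective_iff.1 hinj).eventually
  filter_upwards [hB.eventually hindep] with t ht hηt hdet
  obtain ⟨v, hv, hMv⟩ := Matrix.exists_mulVec_eq_zero_iff.2 hdet
  have hNv : (N t * M₁ t) *ᵥ v = 0 := by
    have hNMv := congrArg (N t *ᵥ ·) hMv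
    simp only [Matrix.mulVec_mulVec, Matrix.mul_add, hker, zero_add, Matrix.mul_smul,
      Matrix.smul_mulVec, Matrix.mulVec_zero] at hNMv
    exact (smul_eq_zero.1 hNMv).resolve_left hηt
  exact hv (Matrix.mulVec_injective_iff.2 ht (by
    simp [Matrix.fromRows_mulVec, hMv, hNv]))

variable {n d : ℕ}

theorem weightedGram_add_smul (A : Fin d → Matrix (Fin n) (Fin n) ℂ)
    (W W' κ : Matrix (Fin n) (Fin n) ℝ) (δ : Fin n → ℝ) (c : ℝ) :
    weightedGram A (W + c • W') κ δ = weightedGram A W κ δ + c • weightedGram A W' κ δ := by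
  ext j s
  simp only [weightedGram, Matrix.of_apply, Matrix.add_apply, Matrix.smul_apply, smul_eq_mul,
    Complex.re_sum, Complex.re_ofReal_mul, add_mul, Finset.sum_add_distrib, Finset.mul_sum,
    mul_assoc]

theorem continuous_weightedGram (A : Fin d → Matrix (Fin n) (Fin n) ℂ) :
    Continuous fun q : Matrix (Fin n) (Fin n) ℝ × Matrix (Fin n) (Fin n) ℝ × (Fin n → ℝ) =>
      weightedGram A q.1 q.2.1 q.2.2 := by
  refine continuous_matrix fun j s => Complex.continuous_re.comp ?_
  refine continuous_finsetSum _ fun k _ => continuous_finsetSum _ fun l _ => ?_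
  simp only [Matrix.mul_apply, Matrix.hadamard_apply, Matrix.map_apply]
  fun_prop

theorem vecMul_weightedGram_vecMulVec {A : Fin d → Matrix (Fin n) (Fin n) ℂ}
    {κ : Matrix (Fin n) (Fin n) ℝ} {u : Fin n → ℝ} {v : Fin d → ℝ}
    (h : star (fun k => (u k : ℂ)) ᵥ* (pencil A v ⊙ κ.map Complex.ofReal) = 0) (δ : Fin n → ℝ) :
    v ᵥ* weightedGram A (Matrix.vecMulVec u u) κ δ = 0 := by
  have hK : pencil A v ⊙ κ.map Complex.ofReal =
      ∑ j, (v j : ℂ) • (A j ⊙ κ.map Complex.ofReal) := by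
    ext k l
    simp only [pencil, Matrix.hadamard_apply, Matrix.sum_apply, Matrix.smul_apply, Finset.sum_mul,
      smul_mul_assoc]
  have hgram : (weightedGram A (Matrix.vecMulVec u u) κ δ)ᵀ =
      Matrix.of fun s j => (star (fun k => (u k : ℂ)) ⬝ᵥ ((A j ⊙ κ.map Complex.ofReal) *
        (Matrix.diagonal fun k => (δ k : ℂ)) * (A s ⊙ κ.map Complex.ofReal)) *ᵥ
          fun k => (u k : ℂ)).re := by
    ext s j
    simp only [weightedGram, Matrix.transpose_apply, Matrix.of_apply,
      star_ofReal_dotProduct_mulVec, Matrix.vecMulVec_apply]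
  rw [← Matrix.mulVec_transpose, hgram]
  ext s
  rw [← re_star_dotProduct_sum_smul_mulVec]
  simp only [← smul_mul_assoc, ← Finset.sum_mul, ← hK]
  rw [Matrix.dotProduct_mulVec, mul_assoc, ← Matrix.vecMul_vecMul, h, Matrix.zero_vecMul,
    zero_dotProduct, Complex.zero_re, Pi.zero_apply]

theorem cauchyKernel_smul {y : ℝ} {c : Fin n → ℝ} (h : ∀ k, |(y • c) k| < 1) :
    cauchyKernel (y • c) =
      cauchyKernel 0 + y ^ 2 • (Matrix.vecMulVec c c ⊙ cauchyKernel (y • c)) := by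
  ext k l
  have hne := one_sub_mul_ne_zero h k l
  simp only [Pi.smul_apply, smul_eq_mul] at hne
  simp only [Matrix.add_apply, Matrix.smul_apply, Matrix.hadamard_apply, Matrix.vecMulVec_apply,
    cauchyKernel_apply, Pi.zero_apply, Pi.smul_apply, smul_eq_mul, mul_zero, sub_zero, inv_one]
  linear_combination mul_inv_cancel₀ hne

theorem tendsto_cauchyKernel_zero {T : Type*} {l : Filter T} {x : T → Fin n → ℝ}
    (hx : Filter.Tendsto x l (𝓝 0)) :
    Filter.Tendsto (fun t => cauchyKernel (x t)) l (𝓝 (Matrix.of 1)) := by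
  have hcont : ContinuousAt (cauchyKernel (n := n)) 0 :=
    continuousAt_pi.2 fun k => continuousAt_pi.2 fun l =>
      ContinuousAt.inv₀ (by fun_prop) (by simp)
  have hlim := hcont.tendsto.comp hx
  rwa [cauchyKernel_zero] at hlim

/-- The weight is a perturbation, of the order of `y ^ 2`, of the rank one matrix of `u`, and at
that matrix the relations `N` make the Gram matrix singular. -/
theorem eventually_det_weightedGram_ne_zero {T m : Type*} [Finite m] {l : Filter T}
    {A : Fin d → Matrix (Fin n) (Fin n) ℂ} {y : T → ℝ} {c z u δ : T → Fin n → ℝ}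
    {N : T → Matrix m (Fin d) ℝ} {c₀ u₀ δ₀ : Fin n → ℝ} {N₀ : Matrix m (Fin d) ℝ}
    (hy : Filter.Tendsto y l (𝓝 0)) (hc : Filter.Tendsto c l (𝓝 c₀))
    (hz : Filter.Tendsto z l (𝓝 0)) (hu : Filter.Tendsto u l (𝓝 u₀))
    (hδ : Filter.Tendsto δ l (𝓝 δ₀)) (hN : Filter.Tendsto N l (𝓝 N₀))
    (hker : ∀ t, N t * weightedGram A (Matrix.vecMulVec (u t) (u t)) (cauchyKernel (z t)) (δ t) = 0)
    (hlim : ∀ v, weightedGram A (Matrix.vecMulVec u₀ u₀) (Matrix.of 1) δ₀ *ᵥ v = 0 →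
      (N₀ * weightedGram A (Matrix.vecMulVec u₀ u₀ ⊙ Matrix.vecMulVec c₀ c₀) (Matrix.of 1) δ₀) *ᵥ v
        = 0 → v = 0) :
    ∀ᶠ t in l, y t ≠ 0 →
      (weightedGram A (Matrix.vecMulVec (u t) (u t) ⊙ cauchyKernel (y t • c t))
        (cauchyKernel (z t)) (δ t)).det ≠ 0 := by
  have hyc : Filter.Tendsto (fun t => y t • c t) l (𝓝 0) := by
    have hsmul := hy.smul hc
    rwa [zero_smul] at hsmul
  have hsmall : ∀ᶠ t in l, ∀ k, |(y t • c t) k| < 1 :=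
    Filter.eventually_all.2 fun k => by
      have hk := (hyc.apply_nhds k).abs
      rw [Pi.zero_apply, abs_zero] at hk
      exact hk.eventually_lt_const one_pos
  have hgram {W : T → Matrix (Fin n) (Fin n) ℝ} {W₀ : Matrix (Fin n) (Fin n) ℝ}
      (hW : Filter.Tendsto W l (𝓝 W₀)) :
      Filter.Tendsto (fun t => weightedGram A (W t) (cauchyKernel (z t)) (δ t)) l
        (𝓝 (weightedGram A W₀ (Matrix.of 1) δ₀)) := by
    have hcomp := ((continuous_weightedGram A).tendsto (W₀, Matrix.of 1, δ₀)).comp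
      (hW.prodMk_nhds ((tendsto_cauchyKernel_zero hz).prodMk_nhds hδ))
    exact hcomp
  have hvec {w : T → Fin n → ℝ} {w₀ : Fin n → ℝ} (hw : Filter.Tendsto w l (𝓝 w₀)) :
      Filter.Tendsto (fun t => Matrix.vecMulVec (w t) (w t)) l (𝓝 (Matrix.vecMulVec w₀ w₀)) :=
    ((continuous_id.matrix_vecMulVec continuous_id).tendsto w₀).comp hw
  have hweight : Filter.Tendsto (fun t => Matrix.vecMulVec (u t) (u t) ⊙
      (Matrix.vecMulVec (c t) (c t) ⊙ cauchyKernel (y t • c t))) l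
      (𝓝 (Matrix.vecMulVec u₀ u₀ ⊙ Matrix.vecMulVec c₀ c₀)) := by
    refine tendsto_pi_nhds.2 fun i => tendsto_pi_nhds.2 fun j => ?_
    have hentry := (((hvec hu).apply_nhds i).apply_nhds j).mul ((((hvec hc).apply_nhds i).apply_nhds
      j).mul (((tendsto_cauchyKernel_zero hyc).apply_nhds i).apply_nhds j))
    simpa only [Matrix.hadamard_apply, Matrix.of_apply, Pi.one_apply, mul_one] using hentry
  have hsq : Filter.Tendsto (fun t => y t ^ 2) l (𝓝 0) := by
    have hpow := hy.pow 2
    rwa [zero_pow two_ne_zero] at hpow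
  filter_upwards [hsmall, eventually_det_add_smul_ne_zero (hgram (hvec hu)) (hgram hweight) hN hsq
    hker hlim] with t ht hdet hyt
  rw [cauchyKernel_smul ht, Matrix.hadamard_add, cauchyKernel_zero, Matrix.hadamard_of_one,
    Matrix.hadamard_smul, weightedGram_add_smul]
  exact hdet (pow_ne_zero 2 hyt)

end Perturbation

/-! ### The seven forms in three variables -/

section Example

open scoped Topology

theorem exampleForms_isHermitian (j : Fin 7) : (exampleForms j).IsHermitian := by
  ext k l
  fin_cases j <;> fin_cases k <;> fin_cases l <;> simp [exampleForms]

open scoped ComplexOrder in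
theorem not_isStronglyPseudoconvex_exampleForms : ¬ IsStronglyPseudoconvex exampleForms := by
  rintro ⟨b, hb⟩
  have hsum : pencil exampleForms b 0 0 + pencil exampleForms b 1 1 +
      (pencil exampleForms b 2 2 + pencil exampleForms b 2 2) = 0 := by
    simp [pencil, exampleForms, Fin.sum_univ_succ]
    ring
  have hpos := add_pos (add_pos (hb.diag_pos (i := 0)) (hb.diag_pos (i := 1)))
    (add_pos (hb.diag_pos (i := 2)) (hb.diag_pos (i := 2)))
  exact hpos.ne' hsum

theorem not_isDNondegenerate_of_lt {n d : ℕ} (h : 2 * n < d)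
    (A : Fin d → Matrix (Fin n) (Fin n) ℂ) : ¬ IsDNondegenerate A := by
  rintro ⟨b, -, V, hV⟩
  set D := columnMatrix A V
  let f : (Fin d → ℝ) →ₗ[ℝ] (Fin n → ℂ) :=
    (Matrix.mulVecLin D).restrictScalars ℝ ∘ₗ Complex.ofRealCLM.toLinearMap.compLeft (Fin d)
  have hker : f.ker ≠ ⊥ := LinearMap.ker_ne_bot_of_finrank_lt (by
    simpa [Module.finrank_pi_fintype, Complex.finrank_real_complex, mul_comm] using h)
  obtain ⟨v, hv, hv0⟩ := (Submodule.ne_bot_iff _).1 hker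
  refine hv0 (Matrix.mulVec_injective_of_isUnit hV ?_)
  have hDv : D *ᵥ (fun j => (v j : ℂ)) = 0 := hv
  have hGram : (Dᴴ * (pencil A b)⁻¹ * D) *ᵥ (fun j => (v j : ℂ)) = 0 := by
    rw [← Matrix.mulVec_mulVec, hDv, Matrix.mulVec_zero]
  ext j
  simpa [Matrix.mulVec, dotProduct] using congrArg Complex.re (congrFun hGram j)

/-- Two independent relations `∑ₖ u_k H_{kl} κ_{kl} = 0` for matrices `H` of the pencil of the
example, `κ` being symmetric: a real symmetric solution and an imaginary antisymmetric one. -/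
def exampleRelations (κ : Matrix (Fin 3) (Fin 3) ℝ) (u : Fin 3 → ℝ) : Matrix (Fin 2) (Fin 7) ℝ :=
  let s := κ 0 1 * (κ 0 0 * u 0 ^ 2 + κ 1 1 * u 1 ^ 2)
  let t := κ 1 2 * (2 * κ 1 1 * u 1 ^ 2 + κ 2 2 * u 2 ^ 2)
  !![-(κ 1 2 * u 1 * s), κ 1 2 * u 1 * s - κ 0 1 * u 1 * t, -(κ 2 2 * u 2 * s), κ 0 0 * u 0 * t,
      0, 0, 0;
    0, 0, 0, 0, -(κ 0 1 * κ 1 2 * u 1), κ 0 1 * κ 0 2 * u 0, κ 0 2 * κ 1 2 * u 2]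

theorem continuous_exampleRelations :
    Continuous fun q : Matrix (Fin 3) (Fin 3) ℝ × (Fin 3 → ℝ) => exampleRelations q.1 q.2 := by
  refine continuous_matrix fun i j => ?_
  fin_cases i <;> fin_cases j <;>
    simp only [exampleRelations, Matrix.of_apply, Matrix.cons_val', Matrix.cons_val, Fin.zero_eta,
      Fin.mk_one, Fin.reduceFinMk] <;> fun_prop

theorem vecMul_pencil_exampleRelations {κ : Matrix (Fin 3) (Fin 3) ℝ} (hκ : κ.IsSymm)
    (u : Fin 3 → ℝ) (i : Fin 2) :
    star (fun k => (u k : ℂ)) ᵥ*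
      (pencil exampleForms (exampleRelations κ u i) ⊙ κ.map Complex.ofReal) = 0 := by
  have h10 := hκ.apply 0 1
  have h20 := hκ.apply 0 2
  have h21 := hκ.apply 1 2
  ext l
  fin_cases i <;> fin_cases l <;>
    simp [Matrix.vecMul, dotProduct, pencil, exampleForms, exampleRelations, Fin.sum_univ_succ,
      h10, h20, h21] <;> ring

theorem exampleRelations_mul_weightedGram {κ : Matrix (Fin 3) (Fin 3) ℝ} (hκ : κ.IsSymm)
    (u δ : Fin 3 → ℝ) :
    exampleRelations κ u * weightedGram exampleForms (Matrix.vecMulVec u u) κ δ = 0 := by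
  ext i s
  exact congrFun (vecMul_weightedGram_vecMulVec (vecMul_pencil_exampleRelations hκ u i) δ) s

theorem eq_zero_of_weightedGram_mulVec_eq_zero {v : Fin 7 → ℝ}
    (h₀ : weightedGram exampleForms (Matrix.vecMulVec 1 1) (Matrix.of 1) ![1, 1, -1] *ᵥ v = 0)
    (h₁ : (exampleRelations (Matrix.of 1) 1 * weightedGram exampleForms
      (Matrix.vecMulVec 1 1 ⊙ Matrix.vecMulVec ![2, 0, 1] ![2, 0, 1]) (Matrix.of 1)
        ![1, 1, -1]) *ᵥ v = 0) : v = 0 := by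
  have e₀ := congrFun h₀ 0
  have e₁ := congrFun h₀ 1
  have e₂ := congrFun h₀ 2
  have e₄ := congrFun h₀ 4
  have e₅ := congrFun h₀ 5
  have f₀ := congrFun h₁ 0
  have f₁ := congrFun h₁ 1
  simp [weightedGram, exampleForms, exampleRelations, Matrix.mulVec, Matrix.mul_apply, dotProduct,
    Fin.sum_univ_succ, Matrix.diagonal] at e₀ e₁ e₂ e₄ e₅ f₀ f₁
  ext j
  fin_cases j <;> simp <;> linarith

theorem eventually_det_weightedGram_exampleForms_ne_zero {T : Type*} {l : Filter T} {y : T → ℝ}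
    {c z u δ : T → Fin 3 → ℝ} (hy : Filter.Tendsto y l (𝓝 0))
    (hc : Filter.Tendsto c l (𝓝 ![2, 0, 1])) (hz : Filter.Tendsto z l (𝓝 0))
    (hu : Filter.Tendsto u l (𝓝 1)) (hδ : Filter.Tendsto δ l (𝓝 ![1, 1, -1])) :
    ∀ᶠ t in l, y t ≠ 0 →
      (weightedGram exampleForms (Matrix.vecMulVec (u t) (u t) ⊙ cauchyKernel (y t • c t))
        (cauchyKernel (z t)) (δ t)).det ≠ 0 := by
  have hrel : Filter.Tendsto (fun t => exampleRelations (cauchyKernel (z t)) (u t)) l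
      (𝓝 (exampleRelations (Matrix.of 1) 1)) := by
    have hlim := (continuous_exampleRelations.tendsto (Matrix.of 1, 1)).comp
      ((tendsto_cauchyKernel_zero hz).prodMk_nhds hu)
    exact hlim
  have hsymm : ∀ t, (cauchyKernel (z t)).IsSymm := fun t =>
    Matrix.IsSymm.ext fun k l => cauchyKernel_comm _ _ _
  exact eventually_det_weightedGram_ne_zero hy hc hz hu hδ hrel
    (fun t => exampleRelations_mul_weightedGram (hsymm t) _ _) fun _ =>
      eq_zero_of_weightedGram_mulVec_eq_zero

/-- The root of `t r² + r + t = 0` that tends to `0` with `t`, for `2 |t| ≤ 1`. -/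
def smallRoot (t : ℝ) : ℝ := -2 * t / (1 + √(1 - 4 * t ^ 2))

theorem one_add_sqrt_pos (s : ℝ) : 0 < 1 + √s := by positivity

@[fun_prop]
theorem continuous_smallRoot : Continuous smallRoot := by
  unfold smallRoot
  exact Continuous.div (by fun_prop) (by fun_prop) fun t => (one_add_sqrt_pos _).ne'

theorem smallRoot_zero : smallRoot 0 = 0 := by simp [smallRoot]

theorem smallRoot_ne_zero {t : ℝ} (ht : t ≠ 0) : smallRoot t ≠ 0 :=
  div_ne_zero (by simpa using ht) (one_add_sqrt_pos _).ne'

theorem smallRoot_eq {t : ℝ} (ht : 2 * |t| ≤ 1) : t * smallRoot t ^ 2 + smallRoot t + t = 0 := by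
  have hpos := (one_add_sqrt_pos (1 - 4 * t ^ 2)).ne'
  have hsq : √(1 - 4 * t ^ 2) ^ 2 = 1 - 4 * t ^ 2 :=
    Real.sq_sqrt (by nlinarith [sq_abs t, abs_nonneg t])
  rw [smallRoot]
  generalize √(1 - 4 * t ^ 2) = s at hpos hsq ⊢
  field_simp
  linear_combination t * hsq

theorem abs_smallRoot_lt_one {t : ℝ} (ht : 2 * |t| < 1) : |smallRoot t| < 1 := by
  rw [smallRoot, abs_div, abs_of_pos (one_add_sqrt_pos _), div_lt_one (one_add_sqrt_pos _),
    abs_mul, abs_neg, abs_two]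
  linarith [Real.sqrt_nonneg (1 - 4 * t ^ 2)]

theorem one_add_mul_smallRoot_pos {t : ℝ} (ht : 2 * |t| < 1) : 0 < 1 + t * smallRoot t := by
  have hlt : |t * smallRoot t| < 1 := by
    rw [abs_mul]
    exact mul_lt_one_of_nonneg_of_lt_one_left (abs_nonneg t) (by linarith [abs_nonneg t])
      (abs_smallRoot_lt_one ht).le
  linarith [(abs_lt.1 hlt).1]

/-- The quotient of the small roots for `2ε` and `ε`. -/
def rootRatio (ε : ℝ) : ℝ := 2 * (1 + √(1 - 4 * ε ^ 2)) / (1 + √(1 - 4 * (2 * ε) ^ 2))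

@[fun_prop]
theorem continuous_rootRatio : Continuous rootRatio := by
  unfold rootRatio
  exact Continuous.div (by fun_prop) (by fun_prop) fun t => (one_add_sqrt_pos _).ne'

theorem rootRatio_zero : rootRatio 0 = 2 := by norm_num [rootRatio]

theorem smallRoot_two_mul (ε : ℝ) : smallRoot (2 * ε) = smallRoot ε * rootRatio ε := by
  rw [smallRoot, smallRoot, rootRatio, mul_comm (_ / _), div_mul_div_comm,
    ← mul_div_mul_right _ _ (one_add_sqrt_pos (1 - 4 * ε ^ 2)).ne']
  ring

/-- The diagonal of the solution `X` in the example. -/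
def exampleRoots (ε : ℝ) : Fin 3 → ℝ := smallRoot ε • ![rootRatio ε, 0, 1]

theorem exampleRoots_eq (ε : ℝ) : exampleRoots ε = ![smallRoot (2 * ε), 0, smallRoot ε] := by
  simp [exampleRoots, smallRoot_two_mul]

@[fun_prop]
theorem continuous_exampleRoots : Continuous exampleRoots := by
  unfold exampleRoots
  fun_prop

theorem exampleRoots_zero : exampleRoots 0 = 0 := by
  rw [exampleRoots, smallRoot_zero, zero_smul]

theorem coeffP_exampleForms (ε : ℝ) : coeffP exampleForms ![(ε : ℂ), (ε : ℂ), 0, 0, 0, 0, 0] =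
    Matrix.diagonal fun k => ((![2 * ε, 0, -ε] : Fin 3 → ℝ) k : ℂ) := by
  ext k l
  fin_cases k <;> fin_cases l <;>
    simp [coeffP, exampleForms, Fin.sum_univ_succ, Matrix.diagonal]
  ring

theorem coeffA_exampleForms (ε : ℝ) : coeffA exampleForms ![1 + 2 * ε, 2 * ε, 0, 0, 0, 0, 0]
    ![(ε : ℂ), (ε : ℂ), 0, 0, 0, 0, 0] =
      Matrix.diagonal fun k => ((![1, 1, -1] : Fin 3 → ℝ) k : ℂ) := by
  ext k l
  fin_cases k <;> fin_cases l <;>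
    simp [coeffA, exampleForms, Fin.sum_univ_succ, Matrix.diagonal] <;> ring

theorem isDiagonalSolution_exampleRoots {ε : ℝ} (hε : 4 * |ε| < 1) :
    IsDiagonalSolution exampleForms ![1 + 2 * ε, 2 * ε, 0, 0, 0, 0, 0]
      ![(ε : ℂ), (ε : ℂ), 0, 0, 0, 0, 0] ![2 * ε, 0, -ε] ![1, 1, -1] (exampleRoots ε) := by
  have h₁ : 2 * |ε| < 1 := by linarith [abs_nonneg ε]
  have h₂ : 2 * |2 * ε| < 1 := by
    rw [abs_mul, abs_two]
    linarith
  rw [exampleRoots_eq]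
  refine ⟨coeffP_exampleForms ε, coeffA_exampleForms ε, ?_, ?_, ?_⟩ <;>
    refine Fin.forall_fin_succ.2 ⟨?_, Fin.forall_fin_two.2 ⟨?_, ?_⟩⟩
  · simpa using smallRoot_eq h₂.le
  · simp
  · change -ε * smallRoot ε ^ 2 + -1 * smallRoot ε + -ε = 0
    linear_combination -smallRoot_eq h₁.le
  · exact abs_smallRoot_lt_one h₂
  · simp
  · exact abs_smallRoot_lt_one h₁
  · exact (one_add_mul_smallRoot_pos h₂).ne'
  · simp
  · change -1 + -ε * smallRoot ε ≠ 0
    have hpos := one_add_mul_smallRoot_pos h₁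
    exact (by linarith : -1 + -ε * smallRoot ε < 0).ne

theorem eventually_isDiagonalSolution_exampleRoots : ∀ᶠ ε : ℝ in 𝓝 0,
    IsDiagonalSolution exampleForms ![1 + 2 * ε, 2 * ε, 0, 0, 0, 0, 0]
      ![(ε : ℂ), (ε : ℂ), 0, 0, 0, 0, 0] ![2 * ε, 0, -ε] ![1, 1, -1] (exampleRoots ε) := by
  have hcont : Continuous fun ε : ℝ => 4 * |ε| := by fun_prop
  exact ((hcont.tendsto' 0 0 (by simp)).eventually_lt_const one_pos).mono fun _ =>
    isDiagonalSolution_exampleRoots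

theorem tendsto_rootDirection :
    Filter.Tendsto (fun ε => ![rootRatio ε, 0, 1]) (𝓝 0) (𝓝 ![2, 0, 1]) := by
  have hcont : Continuous fun ε => ![rootRatio ε, 0, 1] := by fun_prop
  exact hcont.tendsto' _ _ (by rw [rootRatio_zero])

theorem inv_exampleSigns : (fun k => ((![1, 1, -1] : Fin 3 → ℝ) k)⁻¹) = ![1, 1, -1] := by
  ext k
  fin_cases k <;> norm_num

theorem eventually_isDaNondegenerateAt_exampleForms : ∀ᶠ ε : ℝ in 𝓝 0, ε ≠ 0 →
    IsDaNondegenerateAt exampleForms ![1 + 2 * ε, 2 * ε, 0, 0, 0, 0, 0]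
      ![(ε : ℂ), (ε : ℂ), 0, 0, 0, 0, 0] fun k => ((1 : Fin 3 → ℝ) k : ℂ) := by
  have hdet := eventually_det_weightedGram_exampleForms_ne_zero
    (continuous_smallRoot.tendsto' 0 0 smallRoot_zero) tendsto_rootDirection
    (tendsto_const_nhds (x := 0)) (tendsto_const_nhds (x := 1)) tendsto_const_nhds
  filter_upwards [eventually_isDiagonalSolution_exampleRoots, hdet] with ε hsol hdetε hε
  refine hsol.isDaNondegenerateAt exampleForms_isHermitian
    (Fin.forall_fin_succ.2 (by simp)) ?_
  rw [inv_exampleSigns]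
  exact hdetε (smallRoot_ne_zero hε)

theorem eventually_oneJetIsLocalDiffeoAt_exampleForms : ∀ᶠ ε : ℝ in 𝓝 0, ε ≠ 0 →
    OneJetIsLocalDiffeoAt exampleForms ![1 + 2 * ε, 2 * ε, 0, 0, 0, 0, 0]
      (![(ε : ℂ), (ε : ℂ), 0, 0, 0, 0, 0], fun k => ((1 : Fin 3 → ℝ) k : ℂ)) := by
  have hu : Filter.Tendsto (fun ε k => (1 - exampleRoots ε k) ^ 2 * (1 : Fin 3 → ℝ) k) (𝓝 0)
      (𝓝 1) := by
    refine Continuous.tendsto' (by fun_prop) _ _ (funext fun k => ?_)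
    rw [exampleRoots_zero, Pi.zero_apply, sub_zero, one_pow, one_mul]
  have hδ : Filter.Tendsto (fun ε k => ((![1, 1, -1] : Fin 3 → ℝ) k +
      (![2 * ε, 0, -ε] : Fin 3 → ℝ) k * exampleRoots ε k)⁻¹) (𝓝 0) (𝓝 ![1, 1, -1]) := by
    conv => arg 3; rw [← inv_exampleSigns]
    refine tendsto_pi_nhds.2 fun k => Filter.Tendsto.inv₀ ?_ ?_
    · exact Continuous.tendsto' (by fun_prop) _ _ (by simp [exampleRoots_zero])
    · fin_cases k <;> simp
  have hdet := eventually_det_weightedGram_exampleForms_ne_zero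
    (continuous_smallRoot.tendsto' 0 0 smallRoot_zero) tendsto_rootDirection
    (continuous_exampleRoots.tendsto' 0 0 exampleRoots_zero) hu hδ
  filter_upwards [eventually_isDiagonalSolution_exampleRoots, hdet] with ε hsol hdetε hε
  exact hsol.oneJetIsLocalDiffeoAt exampleForms_isHermitian one_ne_zero
    (hdetε (smallRoot_ne_zero hε))

end Example

end

theorem theorem2p5 :
    ¬ IsStronglyPseudoconvex exampleForms ∧
    ¬ IsDNondegenerate exampleForms ∧
    ∃ ε₀ > (0 : ℝ), ∀ ε : ℝ, ε ≠ 0 → |ε| < ε₀ →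
      IsDaNondegenerate exampleForms ![1 + 2 * ε, 2 * ε, 0, 0, 0, 0, 0]
          ![(ε : ℂ), (ε : ℂ), 0, 0, 0, 0, 0] ∧
      IsDaNondegenerateAt exampleForms ![1 + 2 * ε, 2 * ε, 0, 0, 0, 0, 0]
          ![(ε : ℂ), (ε : ℂ), 0, 0, 0, 0, 0] ![1, 1, 1] ∧
      OneJetIsLocalDiffeoAt exampleForms ![1 + 2 * ε, 2 * ε, 0, 0, 0, 0, 0]
          (![(ε : ℂ), (ε : ℂ), 0, 0, 0, 0, 0], ![1, 1, 1]) := by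
  have hwitness : (fun k => ((1 : Fin 3 → ℝ) k : ℂ)) = ![1, 1, 1] := by
    ext k
    fin_cases k <;> simp
  refine ⟨not_isStronglyPseudoconvex_exampleForms,
    not_isDNondegenerate_of_lt (by norm_num) exampleForms, ?_⟩
  obtain ⟨ε₀, hε₀, hball⟩ := Metric.eventually_nhds_iff.1
    (eventually_isDaNondegenerateAt_exampleForms.and eventually_oneJetIsLocalDiffeoAt_exampleForms)
  refine ⟨ε₀, hε₀, fun ε hε hlt => ?_⟩
  obtain ⟨hDa, hJet⟩ := hball (by rwa [Real.dist_0_eq_abs])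
  rw [hwitness] at hDa hJet
  exact ⟨⟨_, hDa hε⟩, hDa hε, hJet hε⟩
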